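/- Let $M$ be a smooth $n$-dimensional manifold (Hausdorff, second countable, without boundary). Let $X:\mathbb R\times M\to TM$, $X_t:=X(t,\cdot)$, be a smooth time-dependent vector field that is complete: every Cauchy problem $\dot\gamma(t)=X_t(\gamma(t))$, $\gamma(t_0)=q_0$ has a solution on all of $\mathbb R$. Let $\phi^{t,s}:M\to M$ map $q$ to the value at time $t$ of the solution with $\gamma(s)=q$. A density on an $n$-dimensional real vector space $V$ is a function $\psi:V^n\to\mathbb R$ with $\psi(Tv_1,\dots,Tv_n)=|\det T|\,\psi(v_1,\dots,v_n)$ for all linear $T:V\to V$; it is positive if it is positive on all linearly independent $n$-tuples. Let $\mathcal DM=\bigsqcup_{q}\mathcal D(T_qM)$ be the density bundle, a smooth line bundle over $M$. The lift of a diffeomorphism $F:M\to M$ is the map $\hat F:\mathcal DM\to\mathcal DM$ that sends $\psi\in\mathcal D(T_qM)$ to the density $(v_1,\dots,v_n)\mapsto\psi(dF^{-1}v_1,\dots,dF^{-1}v_n)$ on $T_{F(q)}M$. A smooth time-dependent flow on a manifold $N$ is a family $\{\Phi^{t,s}\}_{t,s\in\mathbb R}$ of maps $N\to N$, jointly smooth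 in $(t,s,p)$, with $\Phi^{t,t}=\mathrm{id}$ and $\Phi^{t,s}\circ\Phi^{s,r}=\Phi^{t,r}$; its infinitesimal generator is $Y_t(p)=\frac{d}{ds}\big|_{s=t}\Phi^{s,t}(p)$. 1. The maps $\phi^{t,s}$ are diffeomorphisms and form a smooth time-dependent flow on $M$, and their lifts $\widehat{\phi^{t,s}}$ form a smooth time-dependent flow on $\mathcal DM$. The latter has an infinitesimal generator $\hat X$, which is a smooth time-dependent vector field on $\mathcal DM$, and the curves $t\mapsto\widehat{\phi^{t,s}}(\psi)$ are integral curves of $\hat X$. 2. Let $\mu$ be a smooth positive density on $M$. For each $t$ the divergence $\operatorname{div}_\mu X_t$, defined by $\mathcal L_{X_t}\mu=\operatorname{div}_\mu X_t\cdot\mu$ with $\mathcal L_{Y}\mu=\frac{d}{d\tau}\big|_{\tau=0}(\theta_Y^\tau)^*\mu$ for the local flow $\theta_Y$ of $Y$, exists and is smooth in $(t,q)$. The map $\Psi_\mu:\mathbb R\times M\to\mathcal DM$, $(a,q)\mapsto a\mu_q$, is a diffeomorphism, and in this trivialization the generator is $$\hat X_t:(a,q)\mapsto\bigl(-a\operatorname{div}_\mu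 X_t(q),\;X_t(q)\bigr),$$ that is, $d(\Psi_\mu)_{(a,q)}\bigl(-a\operatorname{div}_\mu X_t(q),X_t(q)\bigr)=\hat X_t(a\mu_q)$. 3. Let moreover $\rho_0\in C^\infty(M)$. There is a unique function $\rho:\mathbb R\times M\to\mathbb R$, $\rho_t:=\rho(t,\cdot)$, with $\rho_t\mu=(\phi^{0,t})^*(\rho_0\mu)$ for all $t$; it is smooth, and for all $t\in\mathbb R$, $q\in M$, $$\rho_t(\phi^{t,0}(q))=\exp\Bigl(-\int_0^t\operatorname{div}_\mu X_s(\phi^{s,0}(q))\,ds\Bigr)\rho_0(q).$$ Consequently, if $\rho_0(q)>0$ then $\rho_t(\phi^{t,0}(q))>0$ and $$\log\rho_t(\phi^{t,0}(q))=\log\rho_0(q)-\int_0^t\operatorname{div}_\mu X_s(\phi^{s,0}(q))\,ds .$$ -/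

import Mathlib

open Set Bundle Manifold
open scoped ContDiff
noncomputable section

/-- Densities on an `n`-dimensional real vector space `V`: functions `μ` of `n` vectors with
`μ (T v₁, …, T vₙ) = |det T| μ (v₁, …, vₙ)` for every linear map `T : V → V`. -/
def Density (n : ℕ) (V : Type*) [AddCommGroup V] [Module ℝ V] :
    Submodule ℝ ((Fin n → V) → ℝ) where
  carrier := {μ | ∀ (T : V →ₗ[ℝ] V) (v : Fin n → V),
    μ (fun i => T (v i)) = |LinearMap.det T| * μ v}
  add_mem' := by
    intro μ ν hμ hν T v
    simp only [Pi.add_apply, hμ T v, hν T v, mul_add]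
  zero_mem' := by
    intro T v
    simp
  smul_mem' := by
    intro c μ hμ T v
    simp only [Pi.smul_apply, smul_eq_mul, hμ T v]
    ring

namespace Density

variable {n : ℕ} {V W : Type*} [AddCommGroup V] [Module ℝ V] [AddCommGroup W] [Module ℝ W]

instance : CoeFun (Density n V) (fun _ => (Fin n → V) → ℝ) := ⟨fun μ => μ.1⟩

@[ext] theorem ext {μ ν : Density n V} (h : ∀ v, μ v = ν v) : μ = ν :=
  Subtype.ext (funext h)

theorem map_apply (μ : Density n V) (T : V →ₗ[ℝ] V) (v : Fin n → V) :
    μ (fun i => T (v i)) = |LinearMap.det T| * μ v := μ.2 T v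

@[simp] theorem add_apply (μ ν : Density n V) (v : Fin n → V) : (μ + ν) v = μ v + ν v := rfl

@[simp] theorem smul_apply (c : ℝ) (μ : Density n V) (v : Fin n → V) : (c • μ) v = c * μ v := rfl

theorem apply_eq (μ : Density n V) (e : Module.Basis (Fin n) ℝ V) (v : Fin n → V) :
    μ v = |e.det v| * μ e := by
  have h := map_apply μ (e.constr ℝ v) e
  simp only [Module.Basis.constr_basis] at h
  have h2 := e.det_comp (e.constr ℝ v) e
  rw [e.det_self, mul_one] at h2
  have h3 : (⇑(e.constr ℝ v) ∘ ⇑e) = v := by ext i; simp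
  rw [h3] at h2
  rw [h2]; exact h

/-- The density `|e.det|`, whose value on the basis `e` is `1`. -/
def ofBasis (e : Module.Basis (Fin n) ℝ V) : Density n V :=
  ⟨fun v => |e.det v|, fun T v => by
    have := e.det_comp T v
    rw [← abs_mul, ← this]; rfl⟩

@[simp] theorem ofBasis_apply (e : Module.Basis (Fin n) ℝ V) (v : Fin n → V) :
    ofBasis e v = |e.det v| := rfl

/-- A density is positive when it is positive on every linearly independent tuple. -/
def IsPositive (μ : Density n V) : Prop :=
  ∀ v : Fin n → V, LinearIndependent ℝ v → 0 < μ v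

/-- The pullback `ψ ↦ ψ (A ·, …, A ·)` of densities along a linear map between
`n`-dimensional spaces. -/
def comap [FiniteDimensional ℝ V] [FiniteDimensional ℝ W]
    (hV : Module.finrank ℝ V = n) (hW : Module.finrank ℝ W = n)
    (A : V →ₗ[ℝ] W) (μ : Density n W) : Density n V :=
  ⟨fun v => μ (fun i => A (v i)), fun T v => by
    have b := Module.finBasisOfFinrankEq ℝ V hV
    have e := Module.finBasisOfFinrankEq ℝ W hW
    have key : ∀ v : Fin n → V,
        e.det (fun i => A (v i)) = e.det.compLinearMap A b * b.det v := by
      intro v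
      have := congrArg (fun f => f v) ((e.det.compLinearMap A).eq_smul_basis_det b)
      simpa using this
    have hT : b.det (fun i => T (v i)) = LinearMap.det T * b.det v := b.det_comp T v
    show μ (fun i => A (T (v i))) = |LinearMap.det T| * μ (fun i => A (v i))
    rw [apply_eq μ e (fun i => A (T (v i))), apply_eq μ e (fun i => A (v i)),
      key (fun i => T (v i)), key v, hT, abs_mul, abs_mul, abs_mul]
    ring⟩

@[simp] theorem comap_apply [FiniteDimensional ℝ V] [FiniteDimensional ℝ W]
    (hV : Module.finrank ℝ V = n) (hW : Module.finrank ℝ W = n)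
    (A : V →ₗ[ℝ] W) (μ : Density n W) (v : Fin n → V) :
    comap hV hW A μ v = μ (fun i => A (v i)) := rfl

/-- Evaluation on a basis identifies the space of densities with `ℝ`. -/
def evalBasis (e : Module.Basis (Fin n) ℝ V) : Density n V ≃ₗ[ℝ] ℝ where
  toFun μ := μ e
  invFun c := c • ofBasis e
  map_add' _ _ := rfl
  map_smul' _ _ := rfl
  left_inv μ := by
    ext v
    rw [apply_eq μ e v]
    simp [mul_comm]
  right_inv c := by simp [e.det_self]

end Density


section Bundle

variable (n : ℕ) (M : Type*) [TopologicalSpace M] [ChartedSpace (EuclideanSpace ℝ (Fin n)) M]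

instance TangentSpace.finiteDimensional_euclidean (q : M) :
    FiniteDimensional ℝ (TangentSpace (𝓡 n) q) :=
  inferInstanceAs (FiniteDimensional ℝ (EuclideanSpace ℝ (Fin n)))

variable {M} in
theorem finrank_tangentSpace_euclidean (q : M) :
    Module.finrank ℝ (TangentSpace (𝓡 n) q) = n :=
  finrank_euclideanSpace_fin (𝕜 := ℝ) (n := n)

/-- The standard basis of `ℝⁿ`. -/
abbrev stdBasis : Module.Basis (Fin n) ℝ (EuclideanSpace ℝ (Fin n)) :=
  (EuclideanSpace.basisFun (Fin n) ℝ).toBasis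

/-- The fibre `𝒟(T_q M)` of the density bundle. -/
abbrev DensityFiber (q : M) : Type := Density n (TangentSpace (𝓡 n) q)

/-- The total space `𝒟M` of the density bundle. -/
abbrev DensityBundle : Type _ := TotalSpace ℝ (DensityFiber n M)

variable [IsManifold (𝓡 n) ∞ M]

variable {M} in
/-- The frame of `T_q M` read off from a local trivialization of the tangent bundle; for the
trivialization attached to a chart it is the coordinate frame. -/
def tangentFrame
    (t : Trivialization (EuclideanSpace ℝ (Fin n))
      (π (EuclideanSpace ℝ (Fin n)) (TangentSpace (𝓡 n) : M → Type _)))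
    [MemTrivializationAtlas t] (q : M) (hq : q ∈ t.baseSet) :
    Module.Basis (Fin n) ℝ (TangentSpace (𝓡 n) q) :=
  (stdBasis n).map (t.continuousLinearEquivAt ℝ q hq).symm.toLinearEquiv

open Classical in
variable {M} in
/-- The local trivialization `ψ ↦ ψ(∂₁, …, ∂ₙ)` of the density bundle. -/
def densityPretrivialization
    (t : Trivialization (EuclideanSpace ℝ (Fin n))
      (π (EuclideanSpace ℝ (Fin n)) (TangentSpace (𝓡 n) : M → Type _)))
    [MemTrivializationAtlas t] :
    Pretrivialization ℝ (π ℝ (DensityFiber n M)) where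
  toFun p := ⟨p.1, if h : p.1 ∈ t.baseSet then p.2 (tangentFrame n t p.1 h) else 0⟩
  invFun p := ⟨p.1, if h : p.1 ∈ t.baseSet then
    p.2 • Density.ofBasis (tangentFrame n t p.1 h) else 0⟩
  source := TotalSpace.proj ⁻¹' t.baseSet
  target := t.baseSet ×ˢ univ
  map_source' := fun ⟨_, _⟩ h => ⟨h, mem_univ _⟩
  map_target' := fun ⟨_, _⟩ h => h.1
  left_inv' := fun ⟨x, ψ⟩ h => by
    have h : x ∈ t.baseSet := h
    simp only [h, dif_pos]
    congr 1
    exact (Density.evalBasis (tangentFrame n t x h)).symm_apply_apply ψ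
  right_inv' := fun ⟨x, c⟩ ⟨h, _⟩ => by
    have h : x ∈ t.baseSet := h
    simp only [h, dif_pos]
    congr 1
    exact (Density.evalBasis (tangentFrame n t x h)).apply_symm_apply c
  open_target := t.open_baseSet.prod isOpen_univ
  baseSet := t.baseSet
  open_baseSet := t.open_baseSet
  source_eq := rfl
  target_eq := rfl
  proj_toFun _ _ := rfl

variable {M} in
theorem densityPretrivialization_apply
    (t : Trivialization (EuclideanSpace ℝ (Fin n))
      (π (EuclideanSpace ℝ (Fin n)) (TangentSpace (𝓡 n) : M → Type _)))
    [MemTrivializationAtlas t] (q : M) (hq : q ∈ t.baseSet) (ψ : DensityFiber n M q) :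
    densityPretrivialization n t ⟨q, ψ⟩ = (q, ψ (tangentFrame n t q hq)) :=
  Prod.ext rfl (dif_pos hq)

variable {M} in
theorem densityPretrivialization_symm_apply
    (t : Trivialization (EuclideanSpace ℝ (Fin n))
      (π (EuclideanSpace ℝ (Fin n)) (TangentSpace (𝓡 n) : M → Type _)))
    [MemTrivializationAtlas t] (q : M) (hq : q ∈ t.baseSet) (c : ℝ) :
    (densityPretrivialization n t).symm q c = c • Density.ofBasis (tangentFrame n t q hq) := by
  rw [Pretrivialization.symm_apply _ hq]
  exact eq_of_heq ((cast_heq _ _).trans (heq_of_eq (dif_pos hq)))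

variable {M} in
/-- Coordinate changes of the density bundle: multiplication by `|det|` of the coordinate change of
the tangent bundle. -/
def densityCoordChange
    (t t' : Trivialization (EuclideanSpace ℝ (Fin n))
      (π (EuclideanSpace ℝ (Fin n)) (TangentSpace (𝓡 n) : M → Type _)))
    [MemTrivializationAtlas t] [MemTrivializationAtlas t'] (q : M) : ℝ →L[ℝ] ℝ :=
  |(stdBasis n).det (fun i => t'.coordChangeL ℝ t q (stdBasis n i))| • ContinuousLinearMap.id ℝ ℝ

variable {M} in
theorem densityCoordChange_apply
    (t t' : Trivialization (EuclideanSpace ℝ (Fin n))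
      (π (EuclideanSpace ℝ (Fin n)) (TangentSpace (𝓡 n) : M → Type _)))
    [MemTrivializationAtlas t] [MemTrivializationAtlas t'] (q : M)
    (hq : q ∈ t.baseSet ∩ t'.baseSet) (c : ℝ) :
    densityCoordChange n t t' q c =
      (densityPretrivialization n t' ⟨q, (densityPretrivialization n t).symm q c⟩).2 := by
  rw [densityPretrivialization_apply n t' q hq.2, densityPretrivialization_symm_apply n t q hq.1]
  simp only [densityCoordChange, Density.smul_apply, Density.ofBasis_apply]
  have : (tangentFrame n t q hq.1).det (tangentFrame n t' q hq.2) =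
      (stdBasis n).det (fun i => t'.coordChangeL ℝ t q (stdBasis n i)) := by
    rw [tangentFrame, Module.Basis.det_map]
    congr 1
    funext i
    rw [← Trivialization.comp_continuousLinearEquivAt_eq_coord_change _ _ hq.symm]
    rfl
  rw [this]
  simp [mul_comm]

variable {M} in
theorem contMDiffOn_densityCoordChange
    (t t' : Trivialization (EuclideanSpace ℝ (Fin n))
      (π (EuclideanSpace ℝ (Fin n)) (TangentSpace (𝓡 n) : M → Type _)))
    [MemTrivializationAtlas t] [MemTrivializationAtlas t'] :
    ContMDiffOn (𝓡 n) 𝓘(ℝ, ℝ →L[ℝ] ℝ) ∞ (densityCoordChange n t t')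
      (t.baseSet ∩ t'.baseSet) := by
  have h1 := (contMDiffOn_coordChangeL (n := ∞) (IB := 𝓡 n) t' t)
  rw [inter_comm] at h1
  intro q hq
  have hne : (stdBasis n).det (fun i => t'.coordChangeL ℝ t q (stdBasis n i)) ≠ 0 := by
    exact ((stdBasis n).isUnit_det
      ((stdBasis n).map (t'.coordChangeL ℝ t q).toLinearEquiv)).ne_zero
  have h2 : ContDiff ℝ ∞ (fun L : EuclideanSpace ℝ (Fin n) →L[ℝ] EuclideanSpace ℝ (Fin n) =>
      (stdBasis n).det (fun i => L (stdBasis n i))) := by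
    have : (fun L : EuclideanSpace ℝ (Fin n) →L[ℝ] EuclideanSpace ℝ (Fin n) =>
      (stdBasis n).det (fun i => L (stdBasis n i))) = fun L =>
        ∑ σ : Equiv.Perm (Fin n), ((Equiv.Perm.sign σ : ℤ) : ℝ) *
          ∏ i, (L (stdBasis n i)) (σ i) := by
      funext L
      rw [Module.Basis.det_apply, Matrix.det_apply']
      rfl
    rw [this]
    fun_prop
  have h3 : ContDiffAt ℝ ∞ (fun L : EuclideanSpace ℝ (Fin n) →L[ℝ] EuclideanSpace ℝ (Fin n) =>
      |(stdBasis n).det (fun i => L (stdBasis n i))| • ContinuousLinearMap.id ℝ ℝ)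
      (t'.coordChangeL ℝ t q : EuclideanSpace ℝ (Fin n) →L[ℝ] EuclideanSpace ℝ (Fin n)) := by
    have h4 : ContDiffAt ℝ ∞
        (fun L : EuclideanSpace ℝ (Fin n) →L[ℝ] EuclideanSpace ℝ (Fin n) =>
          |(stdBasis n).det (fun i => L (stdBasis n i))|)
        (t'.coordChangeL ℝ t q : EuclideanSpace ℝ (Fin n) →L[ℝ] EuclideanSpace ℝ (Fin n)) :=
      ContDiffAt.comp (g := fun x : ℝ => |x|) _ (contDiffAt_abs hne) h2.contDiffAt
    exact h4.smul contDiffAt_const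
  exact h3.contMDiffAt.comp_contMDiffWithinAt q (h1 q hq)

/-- The vector prebundle structure of `𝒟M`. -/
def densityPrebundle : VectorPrebundle ℝ ℝ (DensityFiber n M) where
  pretrivializationAtlas := {e | ∃ (t : Trivialization (EuclideanSpace ℝ (Fin n))
      (π (EuclideanSpace ℝ (Fin n)) (TangentSpace (𝓡 n) : M → Type _)))
    (_ : MemTrivializationAtlas t), e = densityPretrivialization n t}
  pretrivialization_linear' := by
    rintro _ ⟨t, ht, rfl⟩
    refine ⟨fun q hq => ⟨fun ψ χ => ?_, fun c ψ => ?_⟩⟩ <;>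
    · simp only [densityPretrivialization_apply n t q hq]
      rfl
  pretrivializationAt q :=
    densityPretrivialization n (trivializationAt (EuclideanSpace ℝ (Fin n)) (TangentSpace (𝓡 n)) q)
  mem_base_pretrivializationAt q :=
    mem_baseSet_trivializationAt (EuclideanSpace ℝ (Fin n)) (TangentSpace (𝓡 n)) q
  pretrivialization_mem_atlas q := ⟨_, inferInstance, rfl⟩
  exists_coordChange := by
    rintro _ ⟨t, ht, rfl⟩ _ ⟨t', ht', rfl⟩
    exact ⟨densityCoordChange n t t', (contMDiffOn_densityCoordChange n t t').continuousOn,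
      densityCoordChange_apply n t t'⟩
  totalSpaceMk_isInducing := by
    intro q
    let e := tangentFrame n
      (trivializationAt (EuclideanSpace ℝ (Fin n)) (TangentSpace (𝓡 n)) q) q
      (mem_baseSet_trivializationAt _ _ _)
    have : FiniteDimensional ℝ (DensityFiber n M q) :=
      (Density.evalBasis e).symm.finiteDimensional
    have h : Topology.IsInducing fun ψ => (q, (Density.evalBasis e).toContinuousLinearEquiv ψ) :=
      Topology.isInducing_const_prod.mpr
        (Density.evalBasis e).toContinuousLinearEquiv.toHomeomorph.isInducing
    convert! h using 1
    funext ψ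
    exact densityPretrivialization_apply n _ q _ ψ

instance densityBundleTopology : TopologicalSpace (DensityBundle n M) :=
  (densityPrebundle n M).totalSpaceTopology

instance densityFiberBundle : FiberBundle ℝ (DensityFiber n M) :=
  (densityPrebundle n M).toFiberBundle

instance densityVectorBundle : VectorBundle ℝ ℝ (DensityFiber n M) :=
  (densityPrebundle n M).toVectorBundle

instance densityPrebundle_isContMDiff : (densityPrebundle n M).IsContMDiff (𝓡 n) ∞ where
  exists_contMDiffCoordChange := by
    rintro _ ⟨t, ht, rfl⟩ _ ⟨t', ht', rfl⟩
    exact ⟨densityCoordChange n t t', contMDiffOn_densityCoordChange n t t',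
      densityCoordChange_apply n t t'⟩

instance densityContMDiffVectorBundle : ContMDiffVectorBundle ∞ ℝ (DensityFiber n M) (𝓡 n) :=
  (densityPrebundle n M).contMDiffVectorBundle (𝓡 n)

end Bundle

section Flows

variable {E : Type*} [NormedAddCommGroup E] [NormedSpace ℝ E] {H : Type*} [TopologicalSpace H]
  (I : ModelWithCorners ℝ E H) {N : Type*} [TopologicalSpace N] [ChartedSpace H N]

/-- A time-dependent vector field is smooth when it is smooth as a map `ℝ × N → TN`. -/
def IsSmoothTimeDepField [IsManifold I ∞ N] (X : ℝ → ∀ q : N, TangentSpace I q) : Prop :=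
  ContMDiff (𝓘(ℝ, ℝ).prod I) I.tangent ∞
    (fun p : ℝ × N => (⟨p.2, X p.1 p.2⟩ : TangentBundle I N))

/-- `γ : ℝ → N` satisfies `γ'(t) = X_t(γ(t))` for all `t`. -/
def IsTimeDepIntegralCurve (X : ℝ → ∀ q : N, TangentSpace I q) (γ : ℝ → N) : Prop :=
  ∀ t : ℝ, HasMFDerivAt 𝓘(ℝ, ℝ) I γ t ((1 : ℝ →L[ℝ] ℝ).smulRight (X t (γ t)))

/-- Every Cauchy problem `γ' = X_t(γ)`, `γ(t₀) = q₀` has a solution defined on all of `ℝ`. -/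
def IsCompleteField (X : ℝ → ∀ q : N, TangentSpace I q) : Prop :=
  ∀ (t₀ : ℝ) (q₀ : N), ∃ γ : ℝ → N, γ t₀ = q₀ ∧ IsTimeDepIntegralCurve I X γ

/-- `timeDepFlow I X hX t₁ t₀ q` is the value at time `t₁` of the solution of the Cauchy problem
with initial time `t₀` and initial point `q`. (On a Hausdorff manifold without boundary the solution
is unique when `X` is smooth.) -/
def timeDepFlow (X : ℝ → ∀ q : N, TangentSpace I q) (hX : IsCompleteField I X)
    (t₁ t₀ : ℝ) (q : N) : N :=
  Classical.choose (hX t₀ q) t₁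

/-- A smooth (global) time-dependent flow. -/
structure IsSmoothTimeDepFlow (Φ : ℝ → ℝ → N → N) : Prop where
  smooth : ContMDiff (𝓘(ℝ, ℝ).prod (𝓘(ℝ, ℝ).prod I)) I ∞
    (fun p : ℝ × ℝ × N => Φ p.1 p.2.1 p.2.2)
  self : ∀ (t : ℝ) (q : N), Φ t t q = q
  comp : ∀ (t₂ t₁ t₀ : ℝ) (q : N), Φ t₂ t₁ (Φ t₁ t₀ q) = Φ t₂ t₀ q

/-- `Y` is the infinitesimal generator of `Φ`: `Y_t(q) = d/ds|_{s = t} Φ^{s,t}(q)`. The base point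
is written `Φ t t q`, which equals `q` for a flow. -/
def IsInfinitesimalGenerator (Φ : ℝ → ℝ → N → N) (Y : ℝ → ∀ q : N, TangentSpace I q) : Prop :=
  ∀ (t : ℝ) (q : N), HasMFDerivAt 𝓘(ℝ, ℝ) I (fun s => Φ s t q) t
    ((1 : ℝ →L[ℝ] ℝ).smulRight (Y t (Φ t t q)))

open Classical in
/-- The local flow of an autonomous vector field: `localFlow I X t q` is the value at time `t` of
the maximal integral curve of `X` starting at `q` (and `q` if that curve does not reach time `t`).
-/
def localFlow (X : ∀ q : N, TangentSpace I q) (t : ℝ) (q : N) : N :=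
  if h : ∃ γ : ℝ → N, γ 0 = q ∧ ∃ a b : ℝ, (0 : ℝ) ∈ Ioo a b ∧ t ∈ Ioo a b ∧
      IsMIntegralCurveOn (I := I) γ X (Ioo a b)
  then Classical.choose h t else q

end Flows

section DensityCalculus

variable {n : ℕ} {M : Type*} [TopologicalSpace M] [ChartedSpace (EuclideanSpace ℝ (Fin n)) M]
  {N : Type*} [TopologicalSpace N] [ChartedSpace (EuclideanSpace ℝ (Fin n)) N]

/-- The pullback density `(F^*ν)_p (v₁, …, vₙ) = ν_{F p} (dF_p v₁, …, dF_p vₙ)`. -/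
def densityPullback (F : M → N) (ν : ∀ q : N, DensityFiber n N q) (p : M) : DensityFiber n M p :=
  Density.comap (finrank_tangentSpace_euclidean n p) (finrank_tangentSpace_euclidean n (F p))
    (mfderiv (𝓡 n) (𝓡 n) F p).toLinearMap (ν (F p))

/-- A smooth section of the density bundle. -/
def IsSmoothDensity [IsManifold (𝓡 n) ∞ M] (μ : ∀ q : M, DensityFiber n M q) : Prop :=
  ContMDiff (𝓡 n) ((𝓡 n).prod 𝓘(ℝ, ℝ)) ∞ (fun q : M => (⟨q, μ q⟩ : DensityBundle n M))

/-- A section of the density bundle that is a positive density at every point. -/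
def IsPositiveDensity (μ : ∀ q : M, DensityFiber n M q) : Prop :=
  ∀ q : M, Density.IsPositive (μ q)

/-- The lift `𝒟M → 𝒟N` of a diffeomorphism `F : M → N`: it sends `ψ ∈ 𝒟(T_q M)` to the density
`(v₁, …, vₙ) ↦ ψ (dF⁻¹ v₁, …, dF⁻¹ vₙ)` on `T_{F q} N`. -/
def densityLift [IsManifold (𝓡 n) ∞ M] [IsManifold (𝓡 n) ∞ N] (F : M ≃ₘ⟮𝓡 n, 𝓡 n⟯ N)
    (ψ : DensityBundle n M) : DensityBundle n N :=
  ⟨F ψ.1, Density.comap (finrank_tangentSpace_euclidean n (F ψ.1))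
    (finrank_tangentSpace_euclidean n ψ.1)
    (F.mfderivToContinuousLinearEquiv (by simp) ψ.1).symm.toLinearEquiv.toLinearMap ψ.2⟩

/-- `(L_X μ)_q = c μ_q`, where `L_X μ = d/dt|_{t = 0} (θ_t)^* μ` is the Lie derivative of `μ` along
`X`, with `θ` the local flow of `X`. -/
def IsDivergenceAt (μ : ∀ q : M, DensityFiber n M q) (X : ∀ q : M, TangentSpace (𝓡 n) q)
    (q : M) (c : ℝ) : Prop :=
  ∀ v : Fin n → TangentSpace (𝓡 n) q,
    HasDerivAt (fun t : ℝ => densityPullback (localFlow (𝓡 n) X t) μ q v) (c * μ q v) 0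

/-- The divergence of `X` with respect to `μ`: the function with `L_X μ = div_μ X · μ`. -/
def divergence (μ : ∀ q : M, DensityFiber n M q) (X : ∀ q : M, TangentSpace (𝓡 n) q) (q : M) : ℝ :=
  Classical.epsilon (fun c : ℝ => IsDivergenceAt μ X q c)

end DensityCalculus

end

/-
The flow is locally a fixed point of the Picard operator on continuous curves, and the implicit
function theorem in that Banach space makes the fixed point depend smoothly on time and initial
value; turning time into an extra coordinate reduces the time-dependent case to the autonomous one.

For a positive density `μ` the lifted flow multiplies by a scalar,
`φ^{t,s}` sending `μ_q` to `J^{t,s}(q) μ_{φ^{t,s}(q)}`, and `J` is a cocycle along the trajectories.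
The derivative of `J^{τ,t}` at `τ = t` is `-div_μ X_t`, because to first order a pullback of `μ`
depends only on the velocity, so the flow `φ` and the local flow of `X_t` give the same Lie
derivative. The cocycle identity turns this into the linear equation
`∂_t J^{t,s} = -(div_μ X_t ∘ φ^{t,s}) J^{t,s}`, whose solution is the exponential of the integral,
and `ρ_t ∘ φ^{t,0} = J^{t,0} ρ₀`.
-/

noncomputable section

open Topology

section PostComposition

variable {K : Type*} [TopologicalSpace K] [CompactSpace K]

/-- The continuous bilinear map of `C(K, F) × C(K, E)` to `C(K, G)` that applies a continuous
bilinear map pointwise. -/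
def pointwiseBilinear (K : Type*) [TopologicalSpace K] [CompactSpace K]
    {F E G : Type*} [NormedAddCommGroup F] [NormedSpace ℝ F] [NormedAddCommGroup E]
    [NormedSpace ℝ E] [NormedAddCommGroup G] [NormedSpace ℝ G] (B : F →L[ℝ] E →L[ℝ] G) :
    C(K, F) →L[ℝ] C(K, E) →L[ℝ] C(K, G) :=
  LinearMap.mkContinuous₂
    (LinearMap.mk₂ ℝ (fun (L : C(K, F)) (β : C(K, E)) =>
        (⟨fun k => B (L k) (β k), by fun_prop⟩ : C(K, G)))
      (fun _ _ _ => by ext; simp) (fun _ _ _ => by ext; simp)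
      (fun _ _ _ => by ext; simp) (fun _ _ _ => by ext; simp))
    ‖B‖ (fun L β => by
      rw [ContinuousMap.norm_le _ (by positivity)]
      intro k
      refine (B.le_opNorm₂ _ _).trans ?_
      gcongr
      exacts [L.norm_coe_le_norm k, β.norm_coe_le_norm k])

theorem hasFDerivAt_postcomp {E G : Type*} [NormedAddCommGroup E] [NormedSpace ℝ E]
    [NormedAddCommGroup G] [NormedSpace ℝ G] (f : C(E, G)) (f' : C(E, E →L[ℝ] G))
    (hf : ∀ x, HasFDerivAt f (f' x) x) (α : C(K, E)) :
    HasFDerivAt (fun α : C(K, E) => f.comp α)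
      (pointwiseBilinear K (.id ℝ (E →L[ℝ] G)) (f'.comp α)) α := by
  rw [hasFDerivAt_iff_isLittleO_nhds_zero, Asymptotics.isLittleO_iff]
  intro c hc
  -- `f'` is uniformly continuous near the compact range of `α`, so the mean value inequality
  -- controls the remainder uniformly in `k`.
  obtain ⟨δ, hδ, hf'δ⟩ := Metric.mem_uniformity_dist.1 <|
    (isCompact_range α.continuous).uniformContinuousAt_of_continuousAt f'
      (fun x _ => f'.continuous.continuousAt) (Metric.dist_mem_uniformity hc)
  filter_upwards [Metric.ball_mem_nhds (0 : C(K, E)) hδ] with β hβ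
  rw [mem_ball_zero_iff] at hβ
  rw [ContinuousMap.norm_le _ (by positivity)]
  intro k
  have hβk : ‖β k‖ < δ := (β.norm_coe_le_norm k).trans_lt hβ
  have hf'_near : ∀ x ∈ Metric.ball (α k) δ, ‖f' x - f' (α k)‖ ≤ c := fun x hx => by
    rw [← dist_eq_norm, dist_comm]
    exact le_of_lt (hf'δ (by rwa [dist_comm]) ⟨k, rfl⟩)
  have hremainder := (convex_ball (α k) δ).norm_image_sub_le_of_norm_hasFDerivWithin_le'
    (f := f) (x := α k) (y := α k + β k) (fun x _ => (hf x).hasFDerivWithinAt) hf'_near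
    (Metric.mem_ball_self hδ) (by simpa using hβk)
  rw [add_sub_cancel_left] at hremainder
  exact hremainder.trans (mul_le_mul_of_nonneg_left (β.norm_coe_le_norm k) hc.le)

theorem contDiff_postcomp_nat.{u} {E : Type u} [NormedAddCommGroup E] [NormedSpace ℝ E] (k : ℕ) :
    ∀ {G : Type u} [NormedAddCommGroup G] [NormedSpace ℝ G] (f : C(E, G)),
      ContDiff ℝ k f → ContDiff ℝ k (fun α : C(K, E) => f.comp α) := by
  induction k with
  | zero =>
    intro G _ _ f _
    exact contDiff_zero.2 (ContinuousMap.continuous_postcomp f)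
  | succ k ih =>
    intro G _ _ f hf
    rw [Nat.cast_succ] at hf ⊢
    obtain ⟨hdiff, -, hfderiv⟩ := contDiff_succ_iff_fderiv.1 hf
    let f' : C(E, E →L[ℝ] G) := ⟨fderiv ℝ f, hfderiv.continuous⟩
    let applyPointwise := pointwiseBilinear K (.id ℝ (E →L[ℝ] G))
    have hderiv : ∀ α : C(K, E),
        HasFDerivAt (fun α : C(K, E) => f.comp α) (applyPointwise (f'.comp α)) α :=
      hasFDerivAt_postcomp f f' fun x => (hdiff x).hasFDerivAt
    refine contDiff_succ_iff_fderiv.2 ⟨fun α => (hderiv α).differentiableAt, by simp, ?_⟩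
    rw [funext fun α => (hderiv α).fderiv]
    exact applyPointwise.contDiff.comp (ih f' hfderiv)

theorem contDiff_postcomp.{u} {E G : Type u} [NormedAddCommGroup E] [NormedSpace ℝ E]
    [NormedAddCommGroup G] [NormedSpace ℝ G] {m : ℕ∞} (f : C(E, G)) (hf : ContDiff ℝ m f) :
    ContDiff ℝ m (fun α : C(K, E) => f.comp α) :=
  contDiff_iff_forall_nat_le.2 fun k hk =>
    contDiff_postcomp_nat k f (hf.of_le (by exact_mod_cast hk))

end PostComposition

section LocalSolution

open intervalIntegral MeasureTheory

variable {E : Type*} [NormedAddCommGroup E] [NormedSpace ℝ E] {a b : ℝ}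

/-- The integration operator `α ↦ (s ↦ ∫_{t₀}^s α)` on `C([a, b], E)`. -/
def integralCLM (E : Type*) [NormedAddCommGroup E] [NormedSpace ℝ E] (t₀ : Icc a b) :
    C(Icc a b, E) →L[ℝ] C(Icc a b, E) :=
  have hab : a ≤ b := t₀.2.1.trans t₀.2.2
  have hint (α : C(Icc a b, E)) (s t : ℝ) : IntervalIntegrable (IccExtend hab α) volume s t :=
    α.continuous.Icc_extend'.intervalIntegrable s t
  LinearMap.mkContinuous
    { toFun := fun α => ⟨fun s => ∫ τ in (t₀ : ℝ)..s, IccExtend hab α τ,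
        (continuous_primitive (hint α) t₀).comp continuous_subtype_val⟩
      map_add' := fun α β => ContinuousMap.ext fun s =>
        integral_add (hint α t₀ s) (hint β t₀ s)
      map_smul' := fun c α => ContinuousMap.ext fun s => integral_smul c _ }
    (b - a) (fun α => by
      rw [ContinuousMap.norm_le _ (mul_nonneg (sub_nonneg.2 hab) (norm_nonneg _))]
      intro s
      refine (norm_integral_le_of_norm_le_const (C := ‖α‖)
        (fun τ _ => α.norm_coe_le_norm _)).trans ?_
      rw [mul_comm]
      have hdist : |(s : ℝ) - t₀| ≤ b - a := abs_sub_le_of_le_of_le s.2.1 s.2.2 t₀.2.1 t₀.2.2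
      exact mul_le_mul_of_nonneg_right hdist (norm_nonneg _))

/-- The defect in the integral equation `α s = x + ε ∫_{t₀}^s f (α τ) dτ`. Its zeros are the
solutions on `[a, b]` of `α' = ε f(α)` with `α t₀ = x`. The time scale `ε` is a parameter because
at `ε = 0` the equation is trivial, on an interval of any length. -/
def picardDefect (f : C(E, E)) (t₀ : Icc a b) (u : (ℝ × E) × C(Icc a b, E)) : C(Icc a b, E) :=
  u.2 - ContinuousLinearMap.const ℝ (Icc a b) u.1.2 - u.1.1 • integralCLM E t₀ (f.comp u.2)

theorem contDiff_picardDefect {f : C(E, E)} (hf : ContDiff ℝ ∞ f) (t₀ : Icc a b) :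
    ContDiff ℝ ∞ (picardDefect f t₀) := by
  have hcomp : ContDiff ℝ ∞ (fun u : (ℝ × E) × C(Icc a b, E) => f.comp u.2) :=
    (contDiff_postcomp f hf).comp contDiff_snd
  unfold picardDefect
  fun_prop

theorem fderiv_picardDefect_comp_inr {f : C(E, E)} (hf : ContDiff ℝ ∞ f) (t₀ : Icc a b) (x : E)
    (α : C(Icc a b, E)) :
    fderiv ℝ (picardDefect f t₀) ((0, x), α) ∘L .inr ℝ (ℝ × E) C(Icc a b, E) =
      ContinuousLinearMap.id ℝ _ := by
  have hpartial : HasFDerivAt (fun α => picardDefect f t₀ ((0, x), α)) _ α :=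
    ((contDiff_picardDefect hf t₀).differentiable (by simp) ((0, x), α)).hasFDerivAt.comp α
      (hasFDerivAt_prodMk_right (0, x) α)
  have hscale_zero : (fun α => picardDefect f t₀ ((0, x), α)) =
      fun α => α - ContinuousLinearMap.const ℝ (Icc a b) x :=
    funext fun α => by simp [picardDefect]
  rw [hscale_zero] at hpartial
  exact hpartial.unique ((hasFDerivAt_id α).sub_const _)

theorem hasDerivAt_of_picardDefect_eq_zero {f : C(E, E)} [CompleteSpace E] {t₀ : Icc a b}
    {ε : ℝ} {x : E} {α : C(Icc a b, E)} (hα : picardDefect f t₀ ((ε, x), α) = 0) :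
    α t₀ = x ∧ ∀ s (hs : s ∈ Ioo a b),
      HasDerivAt (IccExtend (t₀.2.1.trans t₀.2.2) α) (ε • f (α ⟨s, Ioo_subset_Icc_self hs⟩)) s := by
  set α' : ℝ → E := IccExtend (t₀.2.1.trans t₀.2.2) α
  have hsol (s : Icc a b) : α s = x + ε • ∫ τ in (t₀ : ℝ)..s, f (α' τ) := by
    have := congrArg (fun β : C(Icc a b, E) => β s) hα
    simp only [picardDefect, ContinuousMap.sub_apply, ContinuousMap.zero_apply, sub_sub,
      sub_eq_zero] at this
    exact this
  refine ⟨by simpa using hsol t₀, fun s hs => ?_⟩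
  have hcont : Continuous fun τ => f (α' τ) := f.continuous.comp α.continuous.Icc_extend'
  have hderiv := ((hcont.integral_hasStrictDerivAt t₀ s).hasDerivAt.const_smul ε).const_add x
  rw [← IccExtend_of_mem (t₀.2.1.trans t₀.2.2) α (Ioo_subset_Icc_self hs)]
  refine hderiv.congr_of_eventuallyEq ?_
  filter_upwards [Icc_mem_nhds hs.1 hs.2] with τ hτ
  exact (IccExtend_of_mem _ α hτ).trans (hsol ⟨τ, hτ⟩)

theorem exists_contDiffAt_local_solution [CompleteSpace E] {f : E → E} (hf : ContDiff ℝ ∞ f)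
    (x₀ : E) (t₀ : Icc a b) : ∃ A : ℝ × E → C(Icc a b, E),
      ContDiffAt ℝ ∞ A (0, x₀) ∧ A (0, x₀) = ContinuousMap.const _ x₀ ∧
      ∀ᶠ p in 𝓝 ((0 : ℝ), x₀), A p t₀ = p.2 ∧ ∀ s (hs : s ∈ Ioo a b),
        HasDerivAt (IccExtend (t₀.2.1.trans t₀.2.2) (A p))
          (p.1 • f (A p ⟨s, Ioo_subset_Icc_self hs⟩)) s := by
  let fc : C(E, E) := ⟨f, hf.continuous⟩
  let u₀ : (ℝ × E) × C(Icc a b, E) := ((0, x₀), ContinuousMap.const _ x₀)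
  have hsmooth : ContDiffAt ℝ ∞ (picardDefect fc t₀) u₀ :=
    (contDiff_picardDefect (f := fc) hf t₀).contDiffAt
  have hinv : (fderiv ℝ (picardDefect fc t₀) u₀ ∘L .inr ℝ (ℝ × E) C(Icc a b, E)).IsInvertible := by
    rw [fderiv_picardDefect_comp_inr (f := fc) hf]
    exact ⟨ContinuousLinearEquiv.refl ℝ _, rfl⟩
  have hzero : picardDefect fc t₀ u₀ = 0 := by
    ext s
    simp [picardDefect, u₀]
  refine ⟨hsmooth.implicitFunction (by simp) hinv,
    hsmooth.contDiffAt_implicitFunction (by simp) hinv,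
    hsmooth.implicitFunction_apply_self (by simp) hinv, ?_⟩
  filter_upwards [hsmooth.eventually_apply_implicitFunction (by simp) hinv] with p hp
  exact hasDerivAt_of_picardDefect_eq_zero (f := fc) (hp.trans hzero)

end LocalSolution

section ManifoldLocalSolution

theorem exists_contDiff_eventuallyEq {E F : Type*} [NormedAddCommGroup E] [NormedSpace ℝ E]
    [HasContDiffBump E] [NormedAddCommGroup F] [NormedSpace ℝ F] {m : ℕ∞} {v : E → F} {s : Set E}
    {y₀ : E} (hs : s ∈ 𝓝 y₀) (hv : ContDiffOn ℝ m v s) :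
    ∃ f : E → F, ContDiff ℝ m f ∧ f =ᶠ[𝓝 y₀] v := by
  obtain ⟨r, hr, hrs⟩ := Metric.nhds_basis_closedBall.mem_iff.1 (interior_mem_nhds.2 hs)
  let bump : ContDiffBump y₀ := ⟨r / 2, r, half_pos hr, half_lt_self hr⟩
  refine ⟨fun y => bump y • v y, ?_, bump.eventuallyEq_one.mono fun y hy => by simp [hy]⟩
  refine contMDiff_iff_contDiff.1 (contMDiff_of_tsupport fun y hy => ContDiffAt.contMDiffAt ?_)
  have hys : y ∈ interior s := hrs (bump.tsupport_eq ▸ tsupport_smul_subset_left bump v hy)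
  exact bump.contDiff.contDiffAt.smul (hv.contDiffAt (mem_interior_iff_mem_nhds.1 hys))

variable {E : Type*} [NormedAddCommGroup E] [NormedSpace ℝ E] {H : Type*} [TopologicalSpace H]
  {I : ModelWithCorners ℝ E H} {N : Type*} [TopologicalSpace N] [ChartedSpace H N]
  [IsManifold I ∞ N]

/-- The representative of the vector field `V` in the chart at `x₀`. -/
def chartField (I : ModelWithCorners ℝ E H) [IsManifold I ∞ N] (V : ∀ q : N, TangentSpace I q)
    (x₀ : N) (y : E) : E :=
  tangentCoordChange I ((extChartAt I x₀).symm y) x₀ ((extChartAt I x₀).symm y)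
    (V ((extChartAt I x₀).symm y))

theorem contDiffOn_chartField {V : ∀ q : N, TangentSpace I q}
    (hV : ContMDiff I I.tangent ∞ (T% V)) (x₀ : N) :
    ContDiffOn ℝ ∞ (chartField I V x₀) (extChartAt I x₀).target := by
  have hV_chart : ContMDiffOn I 𝓘(ℝ, E) ∞
      (fun q => (trivializationAt E (TangentSpace I) x₀ ⟨q, V q⟩).2) (extChartAt I x₀).source :=
    ((Trivialization.contMDiffOn_iff (e := trivializationAt E (TangentSpace I) x₀)
      (fun q hq => by simpa [TangentBundle.trivializationAt_source] using hq)).1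
      hV.contMDiffOn).2
  exact contMDiffOn_iff_contDiffOn.1 (hV_chart.comp (contMDiffOn_extChartAt_symm (n := ∞) x₀)
    fun y hy => (extChartAt I x₀).map_target hy)

variable [I.Boundaryless]

theorem hasMFDerivAt_extChartAt_symm_comp {x₀ : N} {α : ℝ → E} {t : ℝ}
    (hα : α t ∈ (extChartAt I x₀).target)
    (w : TangentSpace I ((extChartAt I x₀).symm (α t)))
    (h : HasDerivAt α (tangentCoordChange I ((extChartAt I x₀).symm (α t)) x₀
      ((extChartAt I x₀).symm (α t)) w) t) :
    HasMFDerivAt 𝓘(ℝ, ℝ) I (fun s => (extChartAt I x₀).symm (α s)) t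
      ((1 : ℝ →L[ℝ] ℝ).smulRight w) := by
  let x : N := (extChartAt I x₀).symm (α t)
  have hx₀ : x ∈ (extChartAt I x₀).source := (extChartAt I x₀).map_target hα
  have hx : x ∈ (extChartAt I x).source := mem_extChartAt_source x
  let w' : E := w
  have hw' : tangentCoordChange I x₀ x x (tangentCoordChange I x x₀ x w') = w' := by
    rw [tangentCoordChange_comp ⟨⟨hx, hx₀⟩, hx⟩, tangentCoordChange_self hx]
  have hchange : HasFDerivAt (extChartAt I x ∘ (extChartAt I x₀).symm)
      (tangentCoordChange I x₀ x x) (α t) := by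
    apply HasFDerivWithinAt.hasFDerivAt (s := range I) _ (by simp [I.range_eq_univ])
    rw [← (extChartAt I x₀).right_inv hα]
    exact hasFDerivWithinAt_tangentCoordChange ⟨hx₀, hx⟩
  have hderiv : HasDerivAt ((extChartAt I x ∘ (extChartAt I x₀).symm) ∘ α) w' t :=
    (hchange.comp_hasDerivAt t h).congr_deriv hw'
  have hfderiv : HasFDerivAt ((extChartAt I x ∘ (extChartAt I x₀).symm) ∘ α)
      ((1 : ℝ →L[ℝ] ℝ).smulRight w') t :=
    hderiv.hasFDerivAt.congr_fderiv (by ext; simp)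
  exact ⟨(continuousAt_extChartAt_symm'' hα).comp h.continuousAt, hfderiv.hasFDerivWithinAt⟩

theorem exists_contMDiffAt_local_solution [CompleteSpace E] [HasContDiffBump E]
    {V : ∀ q : N, TangentSpace I q} (hV : ContMDiff I I.tangent ∞ (T% V)) (x₀ : N)
    {a b : ℝ} (t₀ : Icc a b) :
    ∃ c : ℝ × N → ℝ → N,
      (∀ t, ContMDiffAt (𝓘(ℝ, ℝ).prod I) I ∞ (fun p => c p t) (0, x₀)) ∧
      ∀ᶠ p in 𝓝 ((0 : ℝ), x₀), c p t₀ = p.2 ∧ IsMIntegralCurveOn (c p) (p.1 • V) (Ioo a b) := by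
  let φ := extChartAt I x₀
  have htarget : φ.target ∈ 𝓝 (φ x₀) := extChartAt_target_mem_nhds x₀
  obtain ⟨f, hf, hfV⟩ := exists_contDiff_eventuallyEq htarget (contDiffOn_chartField hV x₀)
  obtain ⟨A, hA, hA₀, hsol⟩ := exists_contDiffAt_local_solution hf (φ x₀) t₀
  let inChart : ℝ × N → ℝ × E := fun p => (p.1, φ p.2)
  have hinChart : ContMDiffAt (𝓘(ℝ, ℝ).prod I) 𝓘(ℝ, ℝ × E) ∞ inChart (0, x₀) :=
    contMDiffAt_fst.prodMk_space
      (ContMDiffAt.comp (g := φ) ((0 : ℝ), x₀) contMDiffAt_extChartAt contMDiffAt_snd)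
  have hab : a ≤ b := t₀.2.1.trans t₀.2.2
  refine ⟨fun p s => φ.symm (IccExtend hab (A (inChart p)) s), fun t => ?_, ?_⟩
  · have hφ_symm : ContMDiffAt 𝓘(ℝ, E) I ∞ φ.symm (A (inChart (0, x₀)) (projIcc a b hab t)) := by
      rw [show A (inChart (0, x₀)) = _ from hA₀]
      exact (contMDiffOn_extChartAt_symm x₀).contMDiffAt htarget
    have hA_eval : ContDiffAt ℝ ∞ (fun p => A p (projIcc a b hab t)) (0, φ x₀) :=
      (ContinuousMap.evalCLM ℝ (projIcc a b hab t) :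
        C(Icc a b, E) →L[ℝ] E).contDiff.contDiffAt.comp _ hA
    exact ContMDiffAt.comp (g := φ.symm) ((0 : ℝ), x₀) hφ_symm
      (ContMDiffAt.comp (g := fun p => A p (projIcc a b hab t)) _ hA_eval.contMDiffAt hinChart)
  · obtain ⟨U, hU, hU_open, hU_mem⟩ := mem_nhds_iff.1 (Filter.inter_mem htarget hfV)
    have hA_U : ∀ᶠ p in 𝓝 ((0 : ℝ), φ x₀), MapsTo (A p) univ U :=
      hA.continuousAt.eventually <| ContinuousMap.eventually_mapsTo isCompact_univ hU_open <| by
        rw [hA₀]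
        exact fun _ _ => hU_mem
    filter_upwards [hinChart.continuousAt.eventually (hsol.and hA_U),
      continuousAt_snd.eventually (extChartAt_source_mem_nhds (I := I) x₀)]
      with p ⟨⟨hinit, hderiv⟩, hmaps⟩ hp
    refine ⟨by rw [IccExtend_val, hinit]; exact φ.left_inv hp, fun s hs => ?_⟩
    have hs' : s ∈ Icc a b := Ioo_subset_Icc_self hs
    obtain ⟨hmem, hfeq⟩ := hU (hmaps (mem_univ ⟨s, hs'⟩))
    have hextend := (IccExtend_of_mem hab (A (inChart p)) hs').symm
    rw [hextend] at hmem hfeq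
    refine HasMFDerivAt.hasMFDerivWithinAt <|
      hasMFDerivAt_extChartAt_symm_comp hmem _ ((hderiv s hs).congr_deriv ?_)
    rw [hextend, hfeq]
    exact (map_smul (tangentCoordChange I _ x₀ _) p.1 _).symm

end ManifoldLocalSolution

section FlowSmoothness

variable {E : Type*} [NormedAddCommGroup E] [NormedSpace ℝ E]
  {H : Type*} [TopologicalSpace H] {I : ModelWithCorners ℝ E H}
  {N : Type*} [TopologicalSpace N] [ChartedSpace H N]
  {V : ∀ q : N, TangentSpace I q} {θ : ℝ → N → N}

theorem contMDiffAt_flow_of_contMDiffAt {k : WithTop ℕ∞} {s t : ℝ} {x : N}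
    (hadd : ∀ s t x, θ (s + t) x = θ s (θ t x))
    (hs : ContMDiffAt I I k (θ s) x)
    (hts : ContMDiffAt (𝓘(ℝ, ℝ).prod I) I k (fun p : ℝ × N => θ p.1 p.2) (t - s, θ s x)) :
    ContMDiffAt (𝓘(ℝ, ℝ).prod I) I k (fun p : ℝ × N => θ p.1 p.2) (t, x) := by
  have hshift : ContMDiffAt (𝓘(ℝ, ℝ).prod I) (𝓘(ℝ, ℝ).prod I) k
      (fun p : ℝ × N => (p.1 - s, θ s p.2)) (t, x) :=
    (contMDiffAt_fst.sub contMDiffAt_const).prodMk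
      (ContMDiffAt.comp (g := θ s) (t, x) hs contMDiffAt_snd)
  have hcomp := ContMDiffAt.comp (g := fun p : ℝ × N => θ p.1 p.2) (t, x) hts hshift
  refine hcomp.congr_of_eventuallyEq (.of_forall fun p => ?_)
  simp [← hadd]

/-- `θ t q` is the value at time `t` of every integral curve of `V` that starts at `q` and is
defined on an open interval containing `0` and `t`. The notion covers both the flow of a complete
field and `localFlow`, which takes a junk value where no such curve exists. -/
def FollowsIntegralCurves (I : ModelWithCorners ℝ E H) (V : ∀ q : N, TangentSpace I q)
    (θ : ℝ → N → N) : Prop :=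
  ∀ (γ : ℝ → N) (a b t : ℝ), 0 ∈ Ioo a b → t ∈ Ioo a b →
    IsMIntegralCurveOn (I := I) γ V (Ioo a b) → θ t (γ 0) = γ t

variable [I.Boundaryless] [IsManifold I ∞ N]

section Uniqueness

variable [T2Space N]

theorem followsIntegralCurves_localFlow (hV : ContMDiff I I.tangent ∞ (T% V)) :
    FollowsIntegralCurves I V (localFlow I V) := by
  intro γ a b t h0 ht hγ
  have hexists : ∃ γ' : ℝ → N, γ' 0 = γ 0 ∧ ∃ a b : ℝ, (0 : ℝ) ∈ Ioo a b ∧ t ∈ Ioo a b ∧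
      IsMIntegralCurveOn (I := I) γ' V (Ioo a b) := ⟨γ, rfl, a, b, h0, ht, hγ⟩
  rw [localFlow, dif_pos hexists]
  obtain ⟨hstart, a', b', h0', ht', hγ'⟩ := Classical.choose_spec hexists
  have hinter : Ioo (max a a') (min b b') = Ioo a b ∩ Ioo a' b' := Ioo_inter_Ioo.symm
  exact isMIntegralCurveOn_Ioo_eqOn_of_contMDiff_boundaryless (hinter ▸ ⟨h0, h0'⟩)
    (hV.of_le (by simp)) (hγ'.mono (hinter ▸ inter_subset_right))
    (hγ.mono (hinter ▸ inter_subset_left)) hstart (hinter ▸ ⟨ht, ht'⟩)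

theorem followsIntegralCurves_of_isMIntegralCurve (hV : ContMDiff I I.tangent ∞ (T% V))
    (h0 : ∀ x, θ 0 x = x) (hθ : ∀ x, IsMIntegralCurve (I := I) (fun t => θ t x) V) :
    FollowsIntegralCurves I V θ := fun γ _ _ _ h0' ht hγ =>
  isMIntegralCurveOn_Ioo_eqOn_of_contMDiff_boundaryless h0' (hV.of_le (by simp))
    ((hθ (γ 0)).isMIntegralCurveOn _) hγ (h0 _) ht

theorem flow_add_apply (hV : ContMDiff I I.tangent ∞ (T% V)) (h0 : ∀ x, θ 0 x = x)
    (hθ : ∀ x, IsMIntegralCurve (I := I) (fun t => θ t x) V) (s t : ℝ) (x : N) :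
    θ (s + t) x = θ s (θ t x) :=
  congrFun (isMIntegralCurve_Ioo_eq_of_contMDiff_boundaryless (t₀ := 0) (hV.of_le (by simp))
    ((hθ x).comp_add t) (hθ (θ t x)) (by simp [h0])) s

end Uniqueness

variable [CompleteSpace E]

namespace FollowsIntegralCurves

theorem exists_isMIntegralCurveAt (hθ : FollowsIntegralCurves I V θ)
    (hV : ContMDiff I I.tangent ∞ (T% V)) (x : N) :
    ∃ γ : ℝ → N, γ 0 = x ∧ IsMIntegralCurveAt (I := I) γ V 0 ∧
      (fun t => θ t x) =ᶠ[𝓝 0] γ := by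
  obtain ⟨γ, rfl, hγ⟩ := exists_isMIntegralCurveAt_of_contMDiffAt_boundaryless (I := I) 0
    ((hV x).of_le (m := 1) (by simp))
  obtain ⟨ε, hε, hγε⟩ := isMIntegralCurveAt_iff'.1 hγ
  rw [Real.ball_eq_Ioo, zero_sub, zero_add] at hγε
  refine ⟨γ, rfl, hγ, ?_⟩
  filter_upwards [Ioo_mem_nhds (neg_lt_zero.2 hε) hε] with t ht
  exact hθ γ _ _ t ⟨neg_lt_zero.2 hε, hε⟩ ht hγε

theorem zero_apply (hθ : FollowsIntegralCurves I V θ) (hV : ContMDiff I I.tangent ∞ (T% V))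
    (x : N) : θ 0 x = x := by
  obtain ⟨γ, hγ₀, -, hθγ⟩ := hθ.exists_isMIntegralCurveAt hV x
  exact hθγ.eq_of_nhds.trans hγ₀

theorem hasMFDerivAt_zero (hθ : FollowsIntegralCurves I V θ)
    (hV : ContMDiff I I.tangent ∞ (T% V)) (x : N) :
    HasMFDerivAt 𝓘(ℝ, ℝ) I (fun t => θ t x) 0 ((1 : ℝ →L[ℝ] ℝ).smulRight (V x)) := by
  obtain ⟨γ, rfl, hγ, hθγ⟩ := hθ.exists_isMIntegralCurveAt hV x
  exact hγ.hasMFDerivAt.congr_of_eventuallyEq hθγ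

theorem apply_eq_of_isMIntegralCurveOn_smul [T2Space N] (hθ : FollowsIntegralCurves I V θ)
    (hV : ContMDiff I I.tangent ∞ (T% V)) {ε : ℝ} {γ : ℝ → N}
    (hγ : IsMIntegralCurveOn (I := I) γ (ε • V) (Ioo (-2) 2)) : θ ε (γ 0) = γ 1 := by
  rcases eq_or_ne ε 0 with rfl | hε
  · have hzero : ContMDiff I I.tangent 1 (T% ((0 : ℝ) • V)) := by
      simp only [zero_smul]
      exact contMDiff_zeroSection (IB := I) ℝ (TangentSpace I : N → Type _)
    have hconst : IsMIntegralCurve (I := I) (fun _ => γ 0) ((0 : ℝ) • V) :=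
      isMIntegralCurve_const (by simp)
    have hγ_const := isMIntegralCurveOn_Ioo_eqOn_of_contMDiff_boundaryless (t₀ := 0) (by norm_num)
      hzero hγ (hconst.isMIntegralCurveOn _) rfl
    exact (hθ.zero_apply hV _).trans (hγ_const (x := 1) (by norm_num)).symm
  · have hrescaled := (isMIntegralCurveOn_comp_mul_ne_zero (inv_ne_zero hε)).2 hγ
    rw [smul_smul, inv_mul_cancel₀ hε, one_smul] at hrescaled
    have hpos : 0 < |ε| := abs_pos.2 hε
    have hinterval : Ioo (-(2 * |ε|)) (2 * |ε|) ⊆ {t | t * ε⁻¹ ∈ Ioo (-2) 2} := fun t ht => by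
      refine abs_lt.1 ?_
      rw [abs_mul, abs_inv, ← div_eq_mul_inv, div_lt_iff₀ hpos]
      exact abs_lt.2 ht
    have hvalue := hθ _ (-(2 * |ε|)) (2 * |ε|) ε ⟨by linarith, by linarith⟩
      ⟨by linarith [neg_abs_le ε], by linarith [le_abs_self ε]⟩ (hrescaled.mono hinterval)
    simpa [hε] using hvalue

variable [HasContDiffBump E] [T2Space N]

theorem contMDiffAt_zero (hθ : FollowsIntegralCurves I V θ)
    (hV : ContMDiff I I.tangent ∞ (T% V)) (x₀ : N) :
    ContMDiffAt (𝓘(ℝ, ℝ).prod I) I ∞ (fun p : ℝ × N => θ p.1 p.2) (0, x₀) := by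
  obtain ⟨c, hc, hsol⟩ := exists_contMDiffAt_local_solution hV x₀
    (⟨0, by norm_num, by norm_num⟩ : Icc (-2 : ℝ) 2)
  refine (hc 1).congr_of_eventuallyEq (hsol.mono fun p ⟨hinit, hcurve⟩ => ?_)
  refine (congrArg (θ p.1) hinit.symm).trans ?_
  exact hθ.apply_eq_of_isMIntegralCurveOn_smul hV hcurve

end FollowsIntegralCurves

variable [HasContDiffBump E] [T2Space N]

theorem contMDiff_flow_of_isMIntegralCurve (hV : ContMDiff I I.tangent ∞ (T% V))
    (h0 : ∀ x, θ 0 x = x) (hθ : ∀ x, IsMIntegralCurve (I := I) (fun t => θ t x) V) :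
    ContMDiff (𝓘(ℝ, ℝ).prod I) I ∞ (fun p : ℝ × N => θ p.1 p.2) := by
  have hadd := flow_add_apply hV h0 hθ
  have hzero := (followsIntegralCurves_of_isMIntegralCurve hV h0 hθ).contMDiffAt_zero hV
  rw [contMDiff_infty]
  rintro k ⟨t₁, x⟩
  have : IsManifold I k N := IsManifold.of_le (n := ∞) (by exact_mod_cast le_top)
  -- The times at which the flow is `C^k` along the orbit of `x` form a clopen set: a time `t` in
  -- its closure is reached from a time `s` in it by flowing for the short time `t - s`.
  let smoothTimes : Set ℝ :=
    {t | ContMDiffAt (𝓘(ℝ, ℝ).prod I) I k (fun p : ℝ × N => θ p.1 p.2) (t, x)}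
  suffices smoothTimes = univ from (this ▸ mem_univ t₁ : t₁ ∈ smoothTimes)
  have hopen : IsOpen smoothTimes := isOpen_iff_mem_nhds.2 fun t ht =>
    (Continuous.prodMk_left x).continuousAt.eventually
      ((contMDiffAt_iff_contMDiffAt_nhds (by simp)).1 ht)
  refine IsClopen.eq_univ ⟨isClosed_of_closure_subset fun t ht => ?_, hopen⟩
    ⟨0, (hzero x).of_le (by exact_mod_cast le_top)⟩
  have hnear_zero : ∀ᶠ p in 𝓝 ((0 : ℝ), θ t x),
      ContMDiffAt (𝓘(ℝ, ℝ).prod I) I k (fun p : ℝ × N => θ p.1 p.2) p :=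
    (contMDiffAt_iff_contMDiffAt_nhds (by simp)).1
      ((hzero (θ t x)).of_le (by exact_mod_cast le_top))
  have horbit : Continuous fun s => θ s x := (hθ x).continuous
  have hnear : ∀ᶠ s in 𝓝 t, ContMDiffAt (𝓘(ℝ, ℝ).prod I) I k (fun p : ℝ × N => θ p.1 p.2)
      (t - s, θ s x) :=
    have hpath : ContinuousAt (fun s => (t - s, θ s x)) t := by fun_prop
    hpath.eventually (by simpa only [sub_self] using hnear_zero)
  obtain ⟨s, hts, hs⟩ := mem_closure_iff_nhds.1 ht _ hnear
  exact contMDiffAt_flow_of_contMDiffAt hadd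
    (ContMDiffAt.comp (g := fun p : ℝ × N => θ p.1 p.2) x hs
      (contMDiffAt_const.prodMk contMDiffAt_id)) hts

end FlowSmoothness

section Suspension

variable {E : Type*} [NormedAddCommGroup E] [NormedSpace ℝ E] {H : Type*} [TopologicalSpace H]
  {I : ModelWithCorners ℝ E H} {N : Type*} [TopologicalSpace N] [ChartedSpace H N]
  {X : ℝ → ∀ q : N, TangentSpace I q}

/-- The suspension `(1, X)` of a time-dependent vector field `X` on `N`: the autonomous field on
`ℝ × N` whose integral curves are the graphs of those of `X`. -/
def suspension (X : ℝ → ∀ q : N, TangentSpace I q) (p : ℝ × N) :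
    TangentSpace (𝓘(ℝ, ℝ).prod I) p :=
  ((1 : ℝ), X p.1 p.2)

theorem IsTimeDepIntegralCurve.isMIntegralCurve_suspension {γ : ℝ → N}
    (hγ : IsTimeDepIntegralCurve I X γ) (s : ℝ) :
    IsMIntegralCurve (I := 𝓘(ℝ, ℝ).prod I) (fun t => (s + t, γ (s + t))) (suspension X) := by
  have hgraph : IsMIntegralCurve (I := 𝓘(ℝ, ℝ).prod I) (fun t => (t, γ t)) (suspension X) := by
    intro t
    refine ((hasMFDerivAt_id (I := 𝓘(ℝ, ℝ)) t).prodMk (hγ t)).congr_mfderiv ?_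
    ext1
    exact Prod.ext (one_smul ℝ (1 : ℝ)).symm rfl
  simpa only [Function.comp_def, add_comm] using hgraph.comp_add s

theorem timeDepFlow_self (hc : IsCompleteField I X) (t : ℝ) (q : N) :
    timeDepFlow I X hc t t q = q :=
  (Classical.choose_spec (hc t q)).1

theorem isTimeDepIntegralCurve_timeDepFlow (hc : IsCompleteField I X) (s : ℝ) (q : N) :
    IsTimeDepIntegralCurve I X (fun t => timeDepFlow I X hc t s q) :=
  (Classical.choose_spec (hc s q)).2

theorem isInfinitesimalGenerator_timeDepFlow (hc : IsCompleteField I X) :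
    IsInfinitesimalGenerator I (timeDepFlow I X hc) X :=
  fun t q => isTimeDepIntegralCurve_timeDepFlow hc t q t

variable [IsManifold I ∞ N]

theorem IsSmoothTimeDepField.contMDiff_suspension (hX : IsSmoothTimeDepField I X) :
    ContMDiff (𝓘(ℝ, ℝ).prod I) (𝓘(ℝ, ℝ).prod I).tangent ∞ (T% (suspension X)) := by
  have hone : ContMDiff 𝓘(ℝ, ℝ) 𝓘(ℝ, ℝ).tangent ∞
      (fun t : ℝ => (⟨t, (1 : ℝ)⟩ : TangentBundle 𝓘(ℝ, ℝ) ℝ)) :=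
    contMDiff_vectorSpace_iff_contDiff.2 contDiff_const
  exact contMDiff_equivTangentBundleProd_symm.comp ((hone.comp contMDiff_fst).prodMk hX)

theorem IsSmoothTimeDepField.contMDiff_apply (hX : IsSmoothTimeDepField I X) (t : ℝ) :
    ContMDiff I I.tangent ∞ (T% (X t)) :=
  ContMDiff.comp (g := fun p : ℝ × N => (⟨p.2, X p.1 p.2⟩ : TangentBundle I N)) hX
    (contMDiff_const.prodMk contMDiff_id)

variable [T2Space N] [I.Boundaryless]

theorem IsTimeDepIntegralCurve.eq_of_apply_eq (hX : IsSmoothTimeDepField I X) {γ γ' : ℝ → N}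
    (hγ : IsTimeDepIntegralCurve I X γ) (hγ' : IsTimeDepIntegralCurve I X γ') {t₀ : ℝ}
    (h : γ t₀ = γ' t₀) : γ = γ' := by
  have hgraph := isMIntegralCurve_Ioo_eq_of_contMDiff_boundaryless (t₀ := t₀)
    (hX.contMDiff_suspension.of_le (by simp))
    (hγ.isMIntegralCurve_suspension 0) (hγ'.isMIntegralCurve_suspension 0) (by simp [h])
  funext t
  simpa using congrArg Prod.snd (congrFun hgraph t)

theorem timeDepFlow_comp (hX : IsSmoothTimeDepField I X) (hc : IsCompleteField I X)
    (t₂ t₁ t₀ : ℝ) (q : N) :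
    timeDepFlow I X hc t₂ t₁ (timeDepFlow I X hc t₁ t₀ q) = timeDepFlow I X hc t₂ t₀ q :=
  congrFun (IsTimeDepIntegralCurve.eq_of_apply_eq hX (isTimeDepIntegralCurve_timeDepFlow hc t₁ _)
    (isTimeDepIntegralCurve_timeDepFlow hc t₀ q) (timeDepFlow_self hc t₁ _)) t₂

theorem contMDiff_timeDepFlow [CompleteSpace E] [HasContDiffBump (ℝ × E)]
    (hX : IsSmoothTimeDepField I X) (hc : IsCompleteField I X) :
    ContMDiff (𝓘(ℝ, ℝ).prod (𝓘(ℝ, ℝ).prod I)) I ∞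
      (fun p : ℝ × ℝ × N => timeDepFlow I X hc p.1 p.2.1 p.2.2) := by
  have hflow := contMDiff_flow_of_isMIntegralCurve hX.contMDiff_suspension
    (θ := fun t p => (p.1 + t, timeDepFlow I X hc (p.1 + t) p.1 p.2))
    (fun p => by simp [timeDepFlow_self])
    (fun p => (isTimeDepIntegralCurve_timeDepFlow hc p.1 p.2).isMIntegralCurve_suspension p.1)
  have helapsed : ContMDiff (𝓘(ℝ, ℝ).prod (𝓘(ℝ, ℝ).prod I)) (𝓘(ℝ, ℝ).prod (𝓘(ℝ, ℝ).prod I)) ∞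
      (fun p : ℝ × ℝ × N => (p.1 - p.2.1, p.2)) :=
    (contMDiff_fst.sub (contMDiff_fst.comp contMDiff_snd)).prodMk contMDiff_snd
  simpa [Function.comp_def] using contMDiff_snd.comp (hflow.comp helapsed)

theorem isSmoothTimeDepFlow_timeDepFlow [CompleteSpace E] [HasContDiffBump (ℝ × E)]
    (hX : IsSmoothTimeDepField I X) (hc : IsCompleteField I X) :
    IsSmoothTimeDepFlow I (timeDepFlow I X hc) where
  self := timeDepFlow_self hc
  comp := timeDepFlow_comp hX hc
  smooth := contMDiff_timeDepFlow hX hc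

end Suspension

section FlowGenerator

variable {E : Type*} [NormedAddCommGroup E] [NormedSpace ℝ E] {H : Type*} [TopologicalSpace H]
  {I : ModelWithCorners ℝ E H} {N : Type*} [TopologicalSpace N] [ChartedSpace H N]
  {Φ : ℝ → ℝ → N → N}

/-- The infinitesimal generator of a time-dependent flow `Φ`. The derivative is taken at the point
`Φ t t p`, which is `p` for a flow. -/
def flowGenerator (I : ModelWithCorners ℝ E H) (Φ : ℝ → ℝ → N → N) (t : ℝ) (p : N) :
    TangentSpace I p :=
  (mfderiv 𝓘(ℝ, ℝ) I (fun s => Φ s t p) t : ℝ →L[ℝ] E) 1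

theorem tangentBundle_mk_eq {p q : N} (h : p = q) (w : E) :
    (⟨p, w⟩ : TangentBundle I N) = ⟨q, w⟩ := by
  subst h
  rfl

namespace IsSmoothTimeDepFlow

theorem contMDiff_time (hΦ : IsSmoothTimeDepFlow I Φ) (t₀ : ℝ) (p : N) :
    ContMDiff 𝓘(ℝ, ℝ) I ∞ (fun t => Φ t t₀ p) :=
  have hslice : ContMDiff 𝓘(ℝ, ℝ) (𝓘(ℝ, ℝ).prod (𝓘(ℝ, ℝ).prod I)) ∞ (fun t : ℝ => (t, t₀, p)) :=
    contMDiff_id.prodMk contMDiff_const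
  hΦ.smooth.comp hslice

theorem contMDiff_map (hΦ : IsSmoothTimeDepFlow I Φ) (t s : ℝ) : ContMDiff I I ∞ (Φ t s) :=
  have hslice : ContMDiff I (𝓘(ℝ, ℝ).prod (𝓘(ℝ, ℝ).prod I)) ∞ (fun p : N => (t, s, p)) :=
    contMDiff_const.prodMk (contMDiff_const.prodMk contMDiff_id)
  hΦ.smooth.comp hslice

/-- The map `φ^{t,s}` of a smooth time-dependent flow, with inverse `φ^{s,t}`. -/
def diffeomorph (hΦ : IsSmoothTimeDepFlow I Φ) (t s : ℝ) : N ≃ₘ^∞⟮I, I⟯ N where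
  toFun := Φ t s
  invFun := Φ s t
  left_inv q := by rw [hΦ.comp, hΦ.self]
  right_inv q := by rw [hΦ.comp, hΦ.self]
  contMDiff_toFun := hΦ.contMDiff_map t s
  contMDiff_invFun := hΦ.contMDiff_map s t

theorem isInfinitesimalGenerator_flowGenerator (hΦ : IsSmoothTimeDepFlow I Φ) :
    IsInfinitesimalGenerator I Φ (flowGenerator I Φ) := by
  intro t p
  have hderiv := ((hΦ.contMDiff_time t p).mdifferentiable (by simp) t).hasMFDerivAt
  refine hderiv.congr_mfderiv ?_
  ext1
  have hbase : flowGenerator I Φ t (Φ t t p) = (flowGenerator I Φ t p : E) :=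
    congrArg (fun p => (flowGenerator I Φ t p : E)) (hΦ.self t p)
  exact hbase.symm.trans (one_smul ℝ (flowGenerator I Φ t (Φ t t p))).symm

theorem isSmoothTimeDepField_flowGenerator [IsManifold I ∞ N] (hΦ : IsSmoothTimeDepFlow I Φ) :
    IsSmoothTimeDepField I (flowGenerator I Φ) := by
  intro x₀
  have huncurry : ContMDiff ((𝓘(ℝ, ℝ).prod I).prod 𝓘(ℝ, ℝ)) I ∞
      (Function.uncurry fun (x : ℝ × N) s => Φ s x.1 x.2) :=
    hΦ.smooth.comp (contMDiff_snd.prodMk contMDiff_fst)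
  have hmfderiv := ContMDiffAt.mfderiv (x₀ := x₀) (m := ∞) (fun (x : ℝ × N) s => Φ s x.1 x.2)
    (fun x => x.1) huncurry.contMDiffAt contMDiffAt_fst (by simp)
  have hone : ContMDiff (𝓘(ℝ, ℝ).prod I) 𝓘(ℝ, ℝ).tangent ∞
      (fun x : ℝ × N => (⟨x.1, (1 : ℝ)⟩ : TangentBundle 𝓘(ℝ, ℝ) ℝ)) :=
    (contMDiff_vectorSpace_iff_contDiff.2 (contDiff_const (c := (1 : ℝ)))).comp contMDiff_fst
  have hbase : ContMDiff (𝓘(ℝ, ℝ).prod I) I ∞ (fun x : ℝ × N => Φ x.1 x.1 x.2) :=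
    hΦ.smooth.comp (contMDiff_fst.prodMk contMDiff_id)
  have hvelocity := ContMDiffAt.clm_apply_of_inCoordinates
    (F₁ := ℝ) (E₁ := TangentSpace 𝓘(ℝ, ℝ)) (F₂ := E) (E₂ := (TangentSpace I : N → Type _))
    (b₁ := fun x : ℝ × N => x.1) (b₂ := fun x : ℝ × N => Φ x.1 x.1 x.2)
    (ϕ := fun x => mfderiv 𝓘(ℝ, ℝ) I (fun s => Φ s x.1 x.2) x.1)
    (v := fun _ => (1 : ℝ)) hmfderiv hone.contMDiffAt hbase.contMDiffAt
  refine hvelocity.congr_of_eventuallyEq (.of_forall fun x => ?_)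
  exact tangentBundle_mk_eq (hΦ.self x.1 x.2).symm _

end IsSmoothTimeDepFlow

namespace IsInfinitesimalGenerator

variable {X : ℝ → ∀ q : N, TangentSpace I q}

theorem isTimeDepIntegralCurve (hX : IsInfinitesimalGenerator I Φ X)
    (hΦ : IsSmoothTimeDepFlow I Φ) (s : ℝ) (p : N) :
    IsTimeDepIntegralCurve I X (fun t => Φ t s p) := by
  intro t
  have hrestart : (fun t' => Φ t' s p) = fun t' => Φ t' t (Φ t s p) :=
    funext fun t' => (hΦ.comp t' t s p).symm
  have hderiv := hX t (Φ t s p)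
  rwa [hΦ.comp, ← hrestart] at hderiv

theorem eq_flowGenerator (hX : IsInfinitesimalGenerator I Φ X) (hΦ : IsSmoothTimeDepFlow I Φ) :
    X = flowGenerator I Φ := by
  funext t p
  have hmfderiv := congrArg (fun L : ℝ →L[ℝ] E => L 1) (hX t p).mfderiv
  have hbase : (X t (Φ t t p) : E) = X t p :=
    congrArg (fun p => (X t p : E)) (hΦ.self t p)
  exact (hmfderiv.trans ((one_smul ℝ (X t (Φ t t p) : E)).trans hbase)).symm

theorem isSmoothTimeDepField [IsManifold I ∞ N] (hX : IsInfinitesimalGenerator I Φ X)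
    (hΦ : IsSmoothTimeDepFlow I Φ) : IsSmoothTimeDepField I X :=
  hX.eq_flowGenerator hΦ ▸ hΦ.isSmoothTimeDepField_flowGenerator

end IsInfinitesimalGenerator

end FlowGenerator

section Determinant

theorem contDiff_continuousLinearMap_det {𝕜 : Type*} [NontriviallyNormedField 𝕜] [CompleteSpace 𝕜]
    {E : Type*} [NormedAddCommGroup E] [NormedSpace 𝕜 E] [FiniteDimensional 𝕜 E]
    {k : WithTop ℕ∞} : ContDiff 𝕜 k (fun L : E →L[𝕜] E => L.det) := by
  let b := Module.finBasis 𝕜 E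
  have hentry : ∀ i j, ContDiff 𝕜 k (fun L : E →L[𝕜] E => b.repr (L (b j)) i) := fun i j =>
    (b.coord i).toContinuousLinearMap.contDiff.comp
      (ContinuousLinearMap.apply 𝕜 E (b j)).contDiff
  have hdet : (fun L : E →L[𝕜] E => L.det) = fun L => ∑ σ : Equiv.Perm _,
      ((Equiv.Perm.sign σ : ℤ) : 𝕜) * ∏ i, b.repr (L (b i)) (σ i) := by
    funext L
    rw [ContinuousLinearMap.det, ← LinearMap.det_toMatrix b, Matrix.det_apply']
    simp only [LinearMap.toMatrix_apply, ContinuousLinearMap.coe_coe]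
  rw [hdet]
  fun_prop

theorem contDiffAt_abs_det {E : Type*} [NormedAddCommGroup E] [NormedSpace ℝ E]
    [FiniteDimensional ℝ E] {k : ℕ∞} {L₀ : E →L[ℝ] E} (hL₀ : L₀.det ≠ 0) :
    ContDiffAt ℝ k (fun L : E →L[ℝ] E => |L.det|) L₀ :=
  (contDiffAt_abs hL₀).comp L₀ contDiff_continuousLinearMap_det.contDiffAt

end Determinant

section DensityBundleSmoothness

variable {n : ℕ} {M : Type*} [TopologicalSpace M] [ChartedSpace (EuclideanSpace ℝ (Fin n)) M]
  [IsManifold (𝓡 n) ∞ M]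

theorem trivializationAt_density_apply {q₀ q : M}
    (hq : q ∈ (trivializationAt (EuclideanSpace ℝ (Fin n)) (TangentSpace (𝓡 n)) q₀).baseSet)
    (ψ : DensityFiber n M q) :
    (trivializationAt ℝ (DensityFiber n M) q₀ ⟨q, ψ⟩).2 = ψ (tangentFrame n _ q hq) :=
  congrArg Prod.snd (densityPretrivialization_apply n _ q hq ψ)

variable {N : Type*} [TopologicalSpace N] [ChartedSpace (EuclideanSpace ℝ (Fin n)) N]
  [IsManifold (𝓡 n) ∞ N]

theorem density_comp_tangentFrame {p₀ p : M} {q₀ q : N}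
    (hp : p ∈ (trivializationAt (EuclideanSpace ℝ (Fin n)) (TangentSpace (𝓡 n)) p₀).baseSet)
    (hq : q ∈ (trivializationAt (EuclideanSpace ℝ (Fin n)) (TangentSpace (𝓡 n)) q₀).baseSet)
    (A : TangentSpace (𝓡 n) p →L[ℝ] TangentSpace (𝓡 n) q) (ψ : DensityFiber n N q) :
    ψ (fun i => A (tangentFrame n _ p hp i)) =
      |(ContinuousLinearMap.inCoordinates (EuclideanSpace ℝ (Fin n)) (TangentSpace (𝓡 n))
        (EuclideanSpace ℝ (Fin n)) (TangentSpace (𝓡 n)) p₀ p q₀ q A).det| *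
        ψ (tangentFrame n _ q hq) := by
  rw [Density.apply_eq ψ (tangentFrame n _ q hq), ContinuousLinearMap.inCoordinates_eq hp hq]
  congr 2
  refine (Module.Basis.det_map _ _ _).trans ?_
  have hdet := (stdBasis n).det_comp (ContinuousLinearMap.inCoordinates
    (EuclideanSpace ℝ (Fin n)) (TangentSpace (𝓡 n)) (EuclideanSpace ℝ (Fin n))
    (TangentSpace (𝓡 n)) p₀ p q₀ q A).toLinearMap (stdBasis n)
  rw [Module.Basis.det_self, mul_one, ContinuousLinearMap.inCoordinates_eq hp hq] at hdet
  exact hdet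

theorem det_inCoordinates_ne_zero {p : M} {q : N}
    (A : TangentSpace (𝓡 n) p ≃L[ℝ] TangentSpace (𝓡 n) q) :
    (ContinuousLinearMap.inCoordinates (EuclideanSpace ℝ (Fin n)) (TangentSpace (𝓡 n))
      (EuclideanSpace ℝ (Fin n)) (TangentSpace (𝓡 n)) p p q q
      (A : TangentSpace (𝓡 n) p →L[ℝ] TangentSpace (𝓡 n) q)).det ≠ 0 := by
  let e := tangentFrame n _ p (mem_baseSet_trivializationAt _ _ p)
  let e' := tangentFrame n _ q (mem_baseSet_trivializationAt _ _ q)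
  have hdet := density_comp_tangentFrame (mem_baseSet_trivializationAt _ _ p)
    (mem_baseSet_trivializationAt _ _ q) (A : TangentSpace (𝓡 n) p →L[ℝ] TangentSpace (𝓡 n) q)
    (Density.ofBasis e')
  rw [Density.ofBasis_apply, Density.ofBasis_apply, e'.det_self, abs_one, mul_one] at hdet
  rw [← abs_pos, ← hdet, abs_pos]
  exact (e'.isUnit_det (e.map A.toLinearEquiv)).ne_zero

variable {E : Type*} [NormedAddCommGroup E] [NormedSpace ℝ E] {H : Type*} [TopologicalSpace H]
  {J : ModelWithCorners ℝ E H} {P : Type*} [TopologicalSpace P] [ChartedSpace H P]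

theorem contMDiffAt_density_comap {f : P → M} {g : P → N} {x₀ : P}
    {A : ∀ x, TangentSpace (𝓡 n) (f x) →L[ℝ] TangentSpace (𝓡 n) (g x)}
    {ψ : ∀ x, DensityFiber n N (g x)}
    (hdet : ContinuousLinearMap.det (inTangentCoordinates (𝓡 n) (𝓡 n) f g A x₀ x₀) ≠ 0)
    (hA : ContMDiffAt J 𝓘(ℝ, EuclideanSpace ℝ (Fin n) →L[ℝ] EuclideanSpace ℝ (Fin n)) ∞
      (inTangentCoordinates (𝓡 n) (𝓡 n) f g A x₀) x₀)
    (hf : ContMDiffAt J (𝓡 n) ∞ f x₀)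
    (hψ : ContMDiffAt J ((𝓡 n).prod 𝓘(ℝ, ℝ)) ∞
      (fun x => (⟨g x, ψ x⟩ : DensityBundle n N)) x₀) :
    ContMDiffAt J ((𝓡 n).prod 𝓘(ℝ, ℝ)) ∞ (fun x => (⟨f x, Density.comap
      (finrank_tangentSpace_euclidean n (f x)) (finrank_tangentSpace_euclidean n (g x))
      (A x).toLinearMap (ψ x)⟩ : DensityBundle n M)) x₀ := by
  rw [contMDiffAt_totalSpace] at hψ ⊢
  refine ⟨hf, ?_⟩
  have habs := (contDiffAt_abs_det (k := ⊤) hdet).contMDiffAt.comp x₀ hA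
  refine (habs.mul hψ.2).congr_of_eventuallyEq ?_
  filter_upwards [hf.continuousAt ((trivializationAt (EuclideanSpace ℝ (Fin n))
      (TangentSpace (𝓡 n)) (f x₀)).open_baseSet.mem_nhds (mem_baseSet_trivializationAt _ _ _)),
    hψ.1.continuousAt ((trivializationAt (EuclideanSpace ℝ (Fin n))
      (TangentSpace (𝓡 n)) (g x₀)).open_baseSet.mem_nhds (mem_baseSet_trivializationAt _ _ _))]
    with x hfx hgx
  rw [trivializationAt_density_apply hfx]
  refine (density_comp_tangentFrame hfx hgx (A x) (ψ x)).trans ?_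
  exact congrArg _ (trivializationAt_density_apply hgx (ψ x)).symm

end DensityBundleSmoothness

section DiffeomorphDifferential

variable {E E' E'' : Type*} [NormedAddCommGroup E] [NormedSpace ℝ E] [NormedAddCommGroup E']
  [NormedSpace ℝ E'] [NormedAddCommGroup E''] [NormedSpace ℝ E''] {H H' H'' : Type*}
  [TopologicalSpace H] [TopologicalSpace H'] [TopologicalSpace H''] {I : ModelWithCorners ℝ E H}
  {I' : ModelWithCorners ℝ E' H'} {I'' : ModelWithCorners ℝ E'' H''} {M N Q : Type*}
  [TopologicalSpace M] [ChartedSpace H M] [TopologicalSpace N] [ChartedSpace H' N]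
  [TopologicalSpace Q] [ChartedSpace H'' Q]

theorem mfderivToContinuousLinearEquiv_refl (p : M) :
    (Diffeomorph.refl I M ∞).mfderivToContinuousLinearEquiv (by simp) p =
      ContinuousLinearEquiv.refl ℝ (TangentSpace I p) :=
  ContinuousLinearEquiv.ext <| funext fun v =>
    congrArg (fun L : E →L[ℝ] E => L v) (mfderiv_id (I := I) (x := p))

theorem mfderivToContinuousLinearEquiv_symm (F : M ≃ₘ⟮I, I'⟯ N) (p : M) :
    ((F.mfderivToContinuousLinearEquiv (by simp) p).symm :
      TangentSpace I' (F p) →L[ℝ] TangentSpace I p) =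
      (mfderiv I' I F.symm (F p) : E' →L[ℝ] E) := by
  ext v
  refine (ContinuousLinearEquiv.symm_apply_eq _).2 ?_
  have hcomp := mfderiv_comp_apply_of_eq (F p) (F.mdifferentiable (by simp) p)
    (F.symm.mdifferentiable (by simp) (F p)) (F.symm_apply_apply p) v
  have hid : (F ∘ F.symm : N → N) = id := funext F.apply_symm_apply
  rw [hid, mfderiv_id] at hcomp
  exact hcomp

theorem mfderivToContinuousLinearEquiv_trans (F : M ≃ₘ⟮I, I'⟯ N) (G : N ≃ₘ⟮I', I''⟯ Q) (p : M) :
    (F.trans G).mfderivToContinuousLinearEquiv (by simp) p =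
      (F.mfderivToContinuousLinearEquiv (by simp) p).trans
        (G.mfderivToContinuousLinearEquiv (by simp) (F p)) :=
  ContinuousLinearEquiv.ext <| funext <|
    mfderiv_comp_apply p (G.mdifferentiable (by simp) _) (F.mdifferentiable (by simp) p)

end DiffeomorphDifferential

section DensityLift

variable {n : ℕ} {M N Q : Type*} [TopologicalSpace M] [ChartedSpace (EuclideanSpace ℝ (Fin n)) M]
  [TopologicalSpace N] [ChartedSpace (EuclideanSpace ℝ (Fin n)) N]
  [TopologicalSpace Q] [ChartedSpace (EuclideanSpace ℝ (Fin n)) Q]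
  [IsManifold (𝓡 n) ∞ M] [IsManifold (𝓡 n) ∞ N] [IsManifold (𝓡 n) ∞ Q]

theorem densityLift_refl (ψ : DensityBundle n M) :
    densityLift (Diffeomorph.refl (𝓡 n) M ∞) ψ = ψ := by
  rw [densityLift, mfderivToContinuousLinearEquiv_refl]
  rfl

theorem densityLift_trans (F : M ≃ₘ⟮𝓡 n, 𝓡 n⟯ N) (G : N ≃ₘ⟮𝓡 n, 𝓡 n⟯ Q) (ψ : DensityBundle n M) :
    densityLift (F.trans G) ψ = densityLift G (densityLift F ψ) := by
  rw [densityLift, mfderivToContinuousLinearEquiv_trans]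
  rfl

variable {E : Type*} [NormedAddCommGroup E] [NormedSpace ℝ E] {H : Type*} [TopologicalSpace H]
  {J : ModelWithCorners ℝ E H} {P : Type*} [TopologicalSpace P] [ChartedSpace H P]
  [IsManifold J ∞ P]

theorem contMDiff_densityLift {F : P → M ≃ₘ⟮𝓡 n, 𝓡 n⟯ N}
    (hF : ContMDiff (J.prod (𝓡 n)) (𝓡 n) ∞ (fun x : P × M => F x.1 x.2))
    (hFsymm : ContMDiff (J.prod (𝓡 n)) (𝓡 n) ∞ (fun x : P × N => (F x.1).symm x.2)) :
    ContMDiff (J.prod ((𝓡 n).prod 𝓘(ℝ, ℝ))) ((𝓡 n).prod 𝓘(ℝ, ℝ)) ∞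
      (fun x : P × DensityBundle n M => densityLift (F x.1) x.2) := by
  intro x₀
  have hbase : ContMDiffAt (J.prod ((𝓡 n).prod 𝓘(ℝ, ℝ))) (𝓡 n) ∞
      (fun x : P × DensityBundle n M => F x.1 x.2.1) x₀ :=
    (hF.comp (contMDiff_fst.prodMk ((contMDiff_proj (DensityFiber n M)).comp
      contMDiff_snd))).contMDiffAt
  have hinverse : ContMDiff ((J.prod ((𝓡 n).prod 𝓘(ℝ, ℝ))).prod (𝓡 n)) (𝓡 n) ∞
      (Function.uncurry fun (x : P × DensityBundle n M) q => (F x.1).symm q) :=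
    hFsymm.comp ((contMDiff_fst.comp contMDiff_fst).prodMk contMDiff_snd)
  have hdifferential := ContMDiffAt.mfderiv (m := ∞)
    (fun (x : P × DensityBundle n M) q => (F x.1).symm q) _ hinverse.contMDiffAt hbase (by simp)
  simp only [Diffeomorph.symm_apply_apply, ← mfderivToContinuousLinearEquiv_symm] at hdifferential
  exact contMDiffAt_density_comap (det_inCoordinates_ne_zero
    ((F x₀.1).mfderivToContinuousLinearEquiv (by simp) x₀.2.1).symm)
    hdifferential hbase contMDiff_snd.contMDiffAt

end DensityLift

section DensityLiftFlow

variable {n : ℕ} {M : Type*} [TopologicalSpace M] [ChartedSpace (EuclideanSpace ℝ (Fin n)) M]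
  {φ : ℝ → ℝ → (M ≃ₘ⟮𝓡 n, 𝓡 n⟯ M)}

namespace IsSmoothTimeDepFlow

theorem eq_refl (hφ : IsSmoothTimeDepFlow (𝓡 n) (fun t s => φ t s)) (t : ℝ) :
    φ t t = Diffeomorph.refl (𝓡 n) M ∞ :=
  Diffeomorph.ext (hφ.self t)

theorem eq_trans (hφ : IsSmoothTimeDepFlow (𝓡 n) (fun t s => φ t s)) (t₂ t₁ t₀ : ℝ) :
    φ t₂ t₀ = (φ t₁ t₀).trans (φ t₂ t₁) :=
  Diffeomorph.ext fun q => (hφ.comp t₂ t₁ t₀ q).symm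

theorem symm_eq (hφ : IsSmoothTimeDepFlow (𝓡 n) (fun t s => φ t s)) (t s : ℝ) :
    (φ t s).symm = φ s t :=
  Diffeomorph.ext fun q => (φ t s).symm_apply_eq.2 ((hφ.comp t s t q).trans (hφ.self t q)).symm

theorem densityLift [IsManifold (𝓡 n) ∞ M]
    (hφ : IsSmoothTimeDepFlow (𝓡 n) (fun t s => φ t s)) :
    IsSmoothTimeDepFlow ((𝓡 n).prod 𝓘(ℝ, ℝ)) (fun t s => _root_.densityLift (φ t s)) where
  self t ψ := by rw [hφ.eq_refl, densityLift_refl]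
  comp t₂ t₁ t₀ ψ := by rw [hφ.eq_trans t₂ t₁ t₀, densityLift_trans]
  smooth := by
    have hinverse : ContMDiff ((𝓘(ℝ, ℝ).prod 𝓘(ℝ, ℝ)).prod (𝓡 n)) (𝓡 n) ∞
        (fun x : (ℝ × ℝ) × M => (φ x.1.1 x.1.2).symm x.2) := by
      simp only [hφ.symm_eq]
      exact hφ.smooth.comp ((contMDiff_snd.comp contMDiff_fst).prodMk
        ((contMDiff_fst.comp contMDiff_fst).prodMk contMDiff_snd))
    have hforward : ContMDiff ((𝓘(ℝ, ℝ).prod 𝓘(ℝ, ℝ)).prod (𝓡 n)) (𝓡 n) ∞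
        (fun x : (ℝ × ℝ) × M => φ x.1.1 x.1.2 x.2) :=
      hφ.smooth.comp ((contMDiff_fst.comp contMDiff_fst).prodMk
        ((contMDiff_snd.comp contMDiff_fst).prodMk contMDiff_snd))
    exact (contMDiff_densityLift (F := fun x : ℝ × ℝ => φ x.1 x.2) hforward hinverse).comp
      ((contMDiff_fst.prodMk (contMDiff_fst.comp contMDiff_snd)).prodMk
        (contMDiff_snd.comp contMDiff_snd))

end IsSmoothTimeDepFlow

end DensityLiftFlow

section MixedDerivatives

variable {E F : Type*} [NormedAddCommGroup E] [NormedSpace ℝ E] [NormedAddCommGroup F]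
  [NormedSpace ℝ F] {G : ℝ × E → F} {t₀ : ℝ} {y₀ : E}

theorem hasFDerivAt_deriv_slice (hG : ContDiffAt ℝ 2 G (t₀, y₀)) :
    HasFDerivAt (fun y => deriv (fun τ => G (τ, y)) t₀)
      ((fderiv ℝ (fderiv ℝ G) (t₀, y₀) (1, 0)).comp (.inr ℝ ℝ E)) y₀ := by
  have hslice : (fun y => deriv (fun τ => G (τ, y)) t₀) =ᶠ[𝓝 y₀]
      fun y => fderiv ℝ G (t₀, y) (1, 0) := by
    have hdiff := (Continuous.prodMk_right t₀).continuousAt.eventually (hG.eventually (by simp))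
    filter_upwards [hdiff] with y hy
    exact ((hy.differentiableAt (by simp)).hasFDerivAt.comp_hasDerivAt t₀
      ((hasDerivAt_id t₀).prodMk (hasDerivAt_const t₀ y))).deriv
  have hsecond : HasFDerivAt (fderiv ℝ G) (fderiv ℝ (fderiv ℝ G) (t₀, y₀)) (t₀, y₀) :=
    ((hG.fderiv_right (m := 1) (by norm_num)).differentiableAt (by simp)).hasFDerivAt
  have hderiv := (ContinuousLinearMap.apply ℝ F ((1 : ℝ), (0 : E))).hasFDerivAt.comp y₀
    (hsecond.comp y₀ (hasFDerivAt_prodMk_right t₀ y₀))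
  refine (hderiv.congr_fderiv ?_).congr_of_eventuallyEq hslice
  ext w
  exact hG.isSymmSndFDerivAt (by simp) (0, w) (1, 0)

theorem hasDerivAt_fderiv_slice (hG : ContDiffAt ℝ 2 G (t₀, y₀)) :
    HasDerivAt (fun τ => fderiv ℝ (fun y => G (τ, y)) y₀)
      (fderiv ℝ (fun y => deriv (fun τ => G (τ, y)) t₀) y₀) t₀ := by
  have hslice : (fun τ => fderiv ℝ (fun y => G (τ, y)) y₀) =ᶠ[𝓝 t₀]
      fun τ => (fderiv ℝ G (τ, y₀)).comp (.inr ℝ ℝ E) := by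
    have hdiff := (Continuous.prodMk_left y₀).continuousAt.eventually (hG.eventually (by simp))
    filter_upwards [hdiff] with τ hτ
    exact ((hτ.differentiableAt (by simp)).hasFDerivAt.comp y₀
      (hasFDerivAt_prodMk_right τ y₀)).fderiv
  have hsecond : HasFDerivAt (fderiv ℝ G) (fderiv ℝ (fderiv ℝ G) (t₀, y₀)) (t₀, y₀) :=
    ((hG.fderiv_right (m := 1) (by norm_num)).differentiableAt (by simp)).hasFDerivAt
  rw [(hasFDerivAt_deriv_slice hG).fderiv]
  refine HasDerivAt.congr_of_eventuallyEq ?_ hslice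
  exact ((ContinuousLinearMap.compL ℝ E (ℝ × E) F).flip (.inr ℝ ℝ E)).hasFDerivAt.comp_hasDerivAt
    t₀ (hsecond.comp_hasDerivAt t₀ ((hasDerivAt_id t₀).prodMk (hasDerivAt_const t₀ y₀)))

end MixedDerivatives

section Variation

variable {E : Type*} [NormedAddCommGroup E] [NormedSpace ℝ E] {H : Type*} [TopologicalSpace H]
  {I : ModelWithCorners ℝ E H} {M : Type*} [TopologicalSpace M] [ChartedSpace H M]

/-- The family of maps `F τ` is smooth near `(t₀, q)`, is the identity at time `t₀`, and leaves the
identity with velocity `X`. -/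
structure IsVariationOfIdentityAt (I : ModelWithCorners ℝ E H) (F : ℝ → M → M)
    (X : ∀ p : M, TangentSpace I p) (t₀ : ℝ) (q : M) : Prop where
  contMDiffAt : ContMDiffAt (𝓘(ℝ, ℝ).prod I) I ∞ (fun p : ℝ × M => F p.1 p.2) (t₀, q)
  apply_self : ∀ p, F t₀ p = p
  hasMFDerivAt : ∀ p, HasMFDerivAt 𝓘(ℝ, ℝ) I (fun τ => F τ p) t₀
    ((1 : ℝ →L[ℝ] ℝ).smulRight (X p : E))

/-- A family of self-maps of a manifold read in the chart at `q`. -/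
def chartFamily (I : ModelWithCorners ℝ E H) (F : ℝ → M → M) (q : M) (x : ℝ × E) : E :=
  extChartAt I q (F x.1 ((extChartAt I q).symm x.2))

namespace IsVariationOfIdentityAt

variable {F : ℝ → M → M} {X : ∀ p : M, TangentSpace I p} {t₀ : ℝ} {q : M}

theorem chartFamily_self [I.Boundaryless] (hF : IsVariationOfIdentityAt I F X t₀ q) :
    ∀ᶠ y in 𝓝 (extChartAt I q q), chartFamily I F q (t₀, y) = y := by
  filter_upwards [extChartAt_target_mem_nhds (I := I) q] with y hy
  rw [chartFamily, hF.apply_self, (extChartAt I q).right_inv hy]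

theorem eventually_mem_chart_source (hF : IsVariationOfIdentityAt I F X t₀ q) :
    ∀ᶠ τ in 𝓝 t₀, F τ q ∈ (chartAt H q).source :=
  (hF.hasMFDerivAt q).continuousAt.eventually_mem
    ((chartAt H q).open_source.mem_nhds (by simp [hF.apply_self]))

variable [IsManifold I ∞ M]

theorem contDiffAt_chartFamily [I.Boundaryless] (hF : IsVariationOfIdentityAt I F X t₀ q) :
    ContDiffAt ℝ ∞ (chartFamily I F q) (t₀, extChartAt I q q) := by
  have hsymm : ContMDiffAt 𝓘(ℝ, E) I ∞ (extChartAt I q).symm (extChartAt I q q) :=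
    (contMDiffOn_extChartAt_symm q).contMDiffAt (extChartAt_target_mem_nhds q)
  have hpair : ContMDiffAt 𝓘(ℝ, ℝ × E) (𝓘(ℝ, ℝ).prod I) ∞
      (fun x : ℝ × E => (x.1, (extChartAt I q).symm x.2)) (t₀, extChartAt I q q) :=
    contDiff_fst.contMDiff.contMDiffAt.prodMk
      (hsymm.comp (t₀, extChartAt I q q) contDiff_snd.contMDiff.contMDiffAt)
  exact (contMDiffAt_extChartAt.comp_of_eq (hF.contMDiffAt.comp_of_eq hpair (by simp))
    (by simp [hF.apply_self])).contDiffAt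

theorem hasDerivAt_chartFamily [I.Boundaryless] (hF : IsVariationOfIdentityAt I F X t₀ q) :
    ∀ᶠ y in 𝓝 (extChartAt I q q),
      HasDerivAt (fun τ => chartFamily I F q (τ, y)) (chartField I X q y) t₀ := by
  filter_upwards [extChartAt_target_mem_nhds (I := I) q] with y hy
  have : IsManifold I 1 M := IsManifold.of_le (n := ∞) (by simp)
  have hsource := (extChartAt I q).map_target hy
  rw [extChartAt_source] at hsource
  have hchart := (hasMFDerivAt_extChartAt (I := I)
    (by rwa [hF.apply_self] : F t₀ ((extChartAt I q).symm y) ∈ (chartAt H q).source)).comp t₀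
      (hF.hasMFDerivAt _)
  rw [hF.apply_self, mfderiv_chartAt_eq_tangentCoordChange hsource] at hchart
  have hderiv : HasFDerivAt (fun τ => chartFamily I F q (τ, y)) (_ : ℝ →L[ℝ] E) t₀ :=
    hchart.hasFDerivAt
  exact hderiv.hasDerivAt.congr_deriv (congrArg _ (one_smul ℝ _))

theorem hasDerivAt_fderiv_chartFamily [I.Boundaryless]
    (hF : IsVariationOfIdentityAt I F X t₀ q) :
    HasDerivAt (fun τ => fderiv ℝ (fun y => chartFamily I F q (τ, y)) (extChartAt I q q))
      (fderiv ℝ (chartField I X q) (extChartAt I q q)) t₀ := by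
  have hslice := hasDerivAt_fderiv_slice
    (hF.contDiffAt_chartFamily.of_le (WithTop.coe_le_coe.2 le_top))
  have hvelocity : (fun y => deriv (fun τ => chartFamily I F q (τ, y)) t₀) =ᶠ[𝓝 (extChartAt I q q)]
      chartField I X q :=
    hF.hasDerivAt_chartFamily.mono fun y hy => hy.deriv
  rwa [hvelocity.fderiv_eq] at hslice

theorem eventually_mdifferentiableAt (hF : IsVariationOfIdentityAt I F X t₀ q) :
    ∀ᶠ τ in 𝓝 t₀, MDifferentiableAt I I (F τ) q := by
  have : IsManifold I 1 M := IsManifold.of_le (n := ∞) (by simp)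
  have hnear := (contMDiffAt_iff_contMDiffAt_nhds (n := 1) (by simp)).1
    (hF.contMDiffAt.of_le (by simp))
  filter_upwards [(Continuous.prodMk_left q).continuousAt.eventually hnear] with τ hτ
  have hslice : ContMDiffAt I (𝓘(ℝ, ℝ).prod I) 1 (fun p : M => (τ, p)) q :=
    contMDiffAt_const.prodMk contMDiffAt_id
  exact (hτ.comp q hslice).mdifferentiableAt (by simp)

end IsVariationOfIdentityAt

end Variation

section MfderivInCharts

variable {E E' : Type*} [NormedAddCommGroup E] [NormedSpace ℝ E] [NormedAddCommGroup E']
  [NormedSpace ℝ E'] {H H' : Type*} [TopologicalSpace H] [TopologicalSpace H']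
  {I : ModelWithCorners ℝ E H} {I' : ModelWithCorners ℝ E' H'} {M N : Type*}
  [TopologicalSpace M] [ChartedSpace H M] [TopologicalSpace N] [ChartedSpace H' N]
  [IsManifold I 1 M] [IsManifold I' 1 N]

theorem inCoordinates_mfderiv [I.Boundaryless] {F : M → N} {p : M} {q₀ : N}
    (hF : MDifferentiableAt I I' F p) (hq₀ : F p ∈ (chartAt H' q₀).source) :
    ContinuousLinearMap.inCoordinates E (TangentSpace I) E' (TangentSpace I') p p q₀ (F p)
        (mfderiv I I' F p) =
      fderiv ℝ (extChartAt I' q₀ ∘ F ∘ (extChartAt I p).symm) (extChartAt I p p) := by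
  refine (inTangentCoordinates_eq_mfderiv_comp (N := M × N) (f := Prod.fst) (g := Prod.snd)
    (ϕ := fun _ => mfderiv I I' F p) (x₀ := (p, q₀)) (x := (p, F p)) (by simp) hq₀).trans ?_
  have hp : (extChartAt I p).symm (extChartAt I p p) = p := extChartAt_to_inv p
  have hsymm : MDifferentiableWithinAt 𝓘(ℝ, E) I (extChartAt I p).symm (range I)
      (extChartAt I p p) := mdifferentiableWithinAt_extChartAt_symm (by simp)
  rw [I.range_eq_univ, mdifferentiableWithinAt_univ] at hsymm
  have hF' : HasMFDerivAt I I' F ((extChartAt I p).symm (extChartAt I p p))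
      (mfderiv I I' F p : E →L[ℝ] E') := by rw [hp]; exact hF.hasMFDerivAt
  have hchart : HasMFDerivAt I' 𝓘(ℝ, E') (extChartAt I' q₀)
      (F ((extChartAt I p).symm (extChartAt I p p)))
      (mfderiv I' 𝓘(ℝ, E') (extChartAt I' q₀) (F p) : E' →L[ℝ] E') := by
    rw [hp]; exact (mdifferentiableAt_extChartAt hq₀).hasMFDerivAt
  rw [I.range_eq_univ, mfderivWithin_univ]
  have hcomp := hchart.comp (extChartAt I p p)
    (hF'.comp (extChartAt I p p) hsymm.hasMFDerivAt)
  have hderiv : HasFDerivAt (extChartAt I' q₀ ∘ F ∘ (extChartAt I p).symm) (_ : E →L[ℝ] E') _ :=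
    hcomp.hasFDerivAt
  exact hderiv.fderiv.symm

end MfderivInCharts

section DensityInCharts

variable {n : ℕ} {M : Type*} [TopologicalSpace M] [ChartedSpace (EuclideanSpace ℝ (Fin n)) M]
  [IsManifold (𝓡 n) ∞ M] {N : Type*} [TopologicalSpace N]
  [ChartedSpace (EuclideanSpace ℝ (Fin n)) N] [IsManifold (𝓡 n) ∞ N]

/-- The coefficient of a section of the density bundle in the chart at `q`, with respect to the
coordinate density of that chart. -/
def chartDensity (μ : ∀ p : M, DensityFiber n M p) (q : M) (y : EuclideanSpace ℝ (Fin n)) : ℝ :=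
  (trivializationAt ℝ (DensityFiber n M) q
    ⟨(extChartAt (𝓡 n) q).symm y, μ ((extChartAt (𝓡 n) q).symm y)⟩).2

theorem contDiffAt_chartDensity {μ : ∀ p : M, DensityFiber n M p} (hμ : IsSmoothDensity μ) (q : M) :
    ContDiffAt ℝ ∞ (chartDensity μ q) (extChartAt (𝓡 n) q q) :=
  ((contMDiffAt_totalSpace.1 (hμ q)).2.comp_of_eq
    ((contMDiffOn_extChartAt_symm q).contMDiffAt (extChartAt_target_mem_nhds q))
    (extChartAt_to_inv q)).contDiffAt

theorem densityPullback_apply_tangentFrame {F : M → N} {ν : ∀ q : N, DensityFiber n N q} {p : M}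
    {q₀ : N} (hF : MDifferentiableAt (𝓡 n) (𝓡 n) F p)
    (hq₀ : F p ∈ (chartAt (EuclideanSpace ℝ (Fin n)) q₀).source) :
    densityPullback F ν p (tangentFrame n _ p (mem_baseSet_trivializationAt _ _ p)) =
      |(fderiv ℝ (extChartAt (𝓡 n) q₀ ∘ F ∘ (extChartAt (𝓡 n) p).symm)
        (extChartAt (𝓡 n) p p)).det| * chartDensity ν q₀ (extChartAt (𝓡 n) q₀ (F p)) := by
  have hleft : (extChartAt (𝓡 n) q₀).symm (extChartAt (𝓡 n) q₀ (F p)) = F p :=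
    (extChartAt (𝓡 n) q₀).left_inv (by rwa [extChartAt_source])
  have : IsManifold (𝓡 n) 1 M := IsManifold.of_le (n := ∞) (by simp)
  have : IsManifold (𝓡 n) 1 N := IsManifold.of_le (n := ∞) (by simp)
  rw [← inCoordinates_mfderiv hF hq₀, chartDensity, hleft,
    trivializationAt_density_apply (by simpa using hq₀)]
  exact density_comp_tangentFrame _ _ (mfderiv (𝓡 n) (𝓡 n) F p) (ν (F p))

/-- The coefficient of the Lie derivative of the density `μ` along `X`, at the centre of the chart
at `q`. The derivative of `|det|` at the identity is the trace. -/
def chartLieDerivative (μ : ∀ p : M, DensityFiber n M p) (X : ∀ p : M, TangentSpace (𝓡 n) p)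
    (q : M) : ℝ :=
  fderiv ℝ (fun L : EuclideanSpace ℝ (Fin n) →L[ℝ] EuclideanSpace ℝ (Fin n) => |L.det|) (.id ℝ _)
      (fderiv ℝ (chartField (𝓡 n) X q) (extChartAt (𝓡 n) q q)) *
      chartDensity μ q (extChartAt (𝓡 n) q q) +
    fderiv ℝ (chartDensity μ q) (extChartAt (𝓡 n) q q)
      (chartField (𝓡 n) X q (extChartAt (𝓡 n) q q))

theorem IsVariationOfIdentityAt.hasDerivAt_densityPullback {F : ℝ → M → M}
    {X : ∀ p : M, TangentSpace (𝓡 n) p} {t₀ : ℝ} {q : M}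
    (hF : IsVariationOfIdentityAt (𝓡 n) F X t₀ q) {μ : ∀ p : M, DensityFiber n M p}
    (hμ : IsSmoothDensity μ) :
    HasDerivAt (fun τ => densityPullback (F τ) μ q
      (tangentFrame n _ q (mem_baseSet_trivializationAt _ _ q))) (chartLieDerivative μ X q) t₀ := by
  have hfderiv_self : fderiv ℝ (fun y => chartFamily (𝓡 n) F q (t₀, y)) (extChartAt (𝓡 n) q q) =
      .id ℝ _ :=
    (Filter.EventuallyEq.fderiv_eq hF.chartFamily_self).trans fderiv_id
  have hdet_id : (ContinuousLinearMap.id ℝ (EuclideanSpace ℝ (Fin n))).det = 1 := LinearMap.det_id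
  have habs_det : DifferentiableAt ℝ
      (fun L : EuclideanSpace ℝ (Fin n) →L[ℝ] EuclideanSpace ℝ (Fin n) => |L.det|) (.id ℝ _) :=
    (contDiffAt_abs_det (k := 1) (by rw [hdet_id]; norm_num)).differentiableAt (by simp)
  have hdet := HasFDerivAt.comp_hasDerivAt t₀ (hfderiv_self ▸ habs_det.hasFDerivAt)
    hF.hasDerivAt_fderiv_chartFamily
  have hdensity := HasFDerivAt.comp_hasDerivAt t₀ (hF.chartFamily_self.self_of_nhds ▸
    ((contDiffAt_chartDensity hμ q).differentiableAt (by simp)).hasFDerivAt)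
    hF.hasDerivAt_chartFamily.self_of_nhds
  have hprod := hdet.mul hdensity
  rw [chartLieDerivative]
  refine (hprod.congr_of_eventuallyEq ?_).congr_deriv ?_
  · filter_upwards [hF.eventually_mem_chart_source, hF.eventually_mdifferentiableAt]
      with τ hsource hdiff
    rw [densityPullback_apply_tangentFrame hdiff hsource]
    simp only [Pi.mul_apply, Function.comp_apply, chartFamily, extChartAt_to_inv]
    rfl
  · simp only [Function.comp_apply, hfderiv_self, hF.chartFamily_self.self_of_nhds, hdet_id,
      abs_one, one_mul]

end DensityInCharts

section DensityRatio

variable {n : ℕ} {M : Type*} [TopologicalSpace M] [ChartedSpace (EuclideanSpace ℝ (Fin n)) M]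
  {μ : ∀ q : M, DensityFiber n M q}

/-- The quotient `ψ / μ_q` of a density `ψ` on `T_q M` by a reference density, computed on the
standard basis of the model space. -/
def densityRatio (μ : ∀ q : M, DensityFiber n M q) (ψ : DensityBundle n M) : ℝ :=
  ψ.2 (stdBasis n) / μ ψ.1 (stdBasis n)

namespace IsPositiveDensity

theorem apply_basis_pos (hμ : IsPositiveDensity μ) (q : M)
    (e : Module.Basis (Fin n) ℝ (TangentSpace (𝓡 n) q)) : 0 < μ q e :=
  hμ q e e.linearIndependent

theorem densityRatio_mk (hμ : IsPositiveDensity μ) (a : ℝ) (q : M) :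
    densityRatio μ ⟨q, a • μ q⟩ = a :=
  mul_div_cancel_right₀ a (hμ.apply_basis_pos q (stdBasis n)).ne'

theorem densityRatio_smul (hμ : IsPositiveDensity μ) {q : M} (ψ : DensityFiber n M q) :
    densityRatio μ ⟨q, ψ⟩ • μ q = ψ := by
  let e : Module.Basis (Fin n) ℝ (TangentSpace (𝓡 n) q) := stdBasis n
  have hbasis : densityRatio μ ⟨q, ψ⟩ * μ q e = ψ e :=
    div_mul_cancel₀ _ (hμ.apply_basis_pos q e).ne'
  refine Density.ext fun v => ?_
  rw [Density.smul_apply, Density.apply_eq ψ e v, Density.apply_eq (μ q) e v, ← hbasis]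
  exact mul_left_comm _ _ _

end IsPositiveDensity

variable [IsManifold (𝓡 n) ∞ M]

theorem contMDiff_smul_density (hμ : IsSmoothDensity μ) :
    ContMDiff (𝓘(ℝ, ℝ).prod (𝓡 n)) ((𝓡 n).prod 𝓘(ℝ, ℝ)) ∞
      (fun p : ℝ × M => (⟨p.2, p.1 • μ p.2⟩ : DensityBundle n M)) := by
  intro x₀
  have hcoord : ContMDiffAt (𝓘(ℝ, ℝ).prod (𝓡 n)) 𝓘(ℝ, ℝ) ∞
      (fun p : ℝ × M => (trivializationAt ℝ (DensityFiber n M) x₀.2 ⟨p.2, μ p.2⟩).2) x₀ :=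
    (contMDiffAt_totalSpace.1 (hμ x₀.2)).2.comp_of_eq contMDiffAt_snd rfl
  refine contMDiffAt_totalSpace.2
    ⟨contMDiffAt_snd, (contMDiffAt_fst.mul hcoord).congr_of_eventuallyEq ?_⟩
  filter_upwards [continuousAt_snd ((trivializationAt (EuclideanSpace ℝ (Fin n))
    (TangentSpace (𝓡 n)) x₀.2).open_baseSet.mem_nhds (mem_baseSet_trivializationAt _ _ x₀.2))]
    with p hp
  rw [Pi.mul_apply, trivializationAt_density_apply hp, trivializationAt_density_apply hp,
    Density.smul_apply]

theorem IsPositiveDensity.trivializationAt_pos (hμ : IsPositiveDensity μ) {q₀ q : M}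
    (hq : q ∈ (trivializationAt (EuclideanSpace ℝ (Fin n)) (TangentSpace (𝓡 n)) q₀).baseSet) :
    0 < (trivializationAt ℝ (DensityFiber n M) q₀ ⟨q, μ q⟩).2 := by
  rw [trivializationAt_density_apply hq]
  exact hμ.apply_basis_pos q _

theorem contMDiff_densityRatio (hμ : IsSmoothDensity μ) (hpos : IsPositiveDensity μ) :
    ContMDiff ((𝓡 n).prod 𝓘(ℝ, ℝ)) 𝓘(ℝ, ℝ) ∞ (densityRatio μ) := by
  intro ψ₀
  have hproj : ContMDiffAt ((𝓡 n).prod 𝓘(ℝ, ℝ)) (𝓡 n) ∞ (fun ψ : DensityBundle n M => ψ.1) ψ₀ :=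
    contMDiffAt_proj (DensityFiber n M)
  have hnum : ContMDiffAt ((𝓡 n).prod 𝓘(ℝ, ℝ)) 𝓘(ℝ, ℝ) ∞
      (fun ψ : DensityBundle n M => (trivializationAt ℝ (DensityFiber n M) ψ₀.1 ψ).2) ψ₀ :=
    (contMDiffAt_totalSpace.1 contMDiffAt_id).2
  have hden : ContMDiffAt ((𝓡 n).prod 𝓘(ℝ, ℝ)) 𝓘(ℝ, ℝ) ∞ (fun ψ : DensityBundle n M =>
      (trivializationAt ℝ (DensityFiber n M) ψ₀.1 ⟨ψ.1, μ ψ.1⟩).2) ψ₀ :=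
    (contMDiffAt_totalSpace.1 (hμ ψ₀.1)).2.comp_of_eq hproj rfl
  refine (hnum.div₀ hden (hpos.trivializationAt_pos
    (mem_baseSet_trivializationAt _ _ ψ₀.1)).ne').congr_of_eventuallyEq ?_
  filter_upwards [hproj.continuousAt ((trivializationAt (EuclideanSpace ℝ (Fin n))
    (TangentSpace (𝓡 n)) ψ₀.1).open_baseSet.mem_nhds (mem_baseSet_trivializationAt _ _ ψ₀.1))]
    with ψ hψ
  rw [Pi.div_apply, eq_div_iff (hpos.trivializationAt_pos hψ).ne',
    trivializationAt_density_apply hψ, ← Density.smul_apply, hpos.densityRatio_smul]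
  exact (trivializationAt_density_apply hψ ψ.2).symm

/-- The global trivialization `(a, q) ↦ a μ_q` of the density bundle given by a smooth positive
density. -/
def densityDiffeomorph (hμ : IsSmoothDensity μ) (hpos : IsPositiveDensity μ) :
    (ℝ × M) ≃ₘ⟮𝓘(ℝ, ℝ).prod (𝓡 n), (𝓡 n).prod 𝓘(ℝ, ℝ)⟯ DensityBundle n M where
  toFun p := ⟨p.2, p.1 • μ p.2⟩
  invFun ψ := (densityRatio μ ψ, ψ.1)
  left_inv p := Prod.ext (hpos.densityRatio_mk p.1 p.2) rfl
  right_inv ψ := congrArg (TotalSpace.mk ψ.1) (hpos.densityRatio_smul ψ.2)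
  contMDiff_toFun := contMDiff_smul_density hμ
  contMDiff_invFun := (contMDiff_densityRatio hμ hpos).prodMk (contMDiff_proj (DensityFiber n M))

end DensityRatio

section DensityJacobian

variable {n : ℕ} {M N Q : Type*} [TopologicalSpace M] [ChartedSpace (EuclideanSpace ℝ (Fin n)) M]
  [TopologicalSpace N] [ChartedSpace (EuclideanSpace ℝ (Fin n)) N]
  [TopologicalSpace Q] [ChartedSpace (EuclideanSpace ℝ (Fin n)) Q]
  [IsManifold (𝓡 n) ∞ M] [IsManifold (𝓡 n) ∞ N] [IsManifold (𝓡 n) ∞ Q]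
  {μ : ∀ q : M, DensityFiber n M q} {ν : ∀ q : N, DensityFiber n N q}
  {χ : ∀ q : Q, DensityFiber n Q q}

/-- The factor `j` in `F̂ μ_q = j ν_{F q}`: the reciprocal of the absolute Jacobian determinant of
`F` with respect to `μ` and `ν`. -/
def densityJacobian (μ : ∀ q : M, DensityFiber n M q) (ν : ∀ q : N, DensityFiber n N q)
    (F : M ≃ₘ⟮𝓡 n, 𝓡 n⟯ N) (q : M) : ℝ :=
  densityRatio ν (densityLift F ⟨q, μ q⟩)

theorem densityLift_smul (hν : IsPositiveDensity ν) (F : M ≃ₘ⟮𝓡 n, 𝓡 n⟯ N) (a : ℝ) (q : M) :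
    densityLift F ⟨q, a • μ q⟩ = ⟨F q, (a * densityJacobian μ ν F q) • ν (F q)⟩ := by
  rw [mul_smul]
  exact congrArg (fun ψ : DensityFiber n N (F q) => (⟨F q, a • ψ⟩ : DensityBundle n N))
    (hν.densityRatio_smul (densityLift F ⟨q, μ q⟩).2).symm

theorem densityJacobian_refl (hμ : IsPositiveDensity μ) (q : M) :
    densityJacobian μ μ (Diffeomorph.refl (𝓡 n) M ∞) q = 1 := by
  rw [densityJacobian, densityLift_refl, ← one_smul ℝ (μ q), hμ.densityRatio_mk]

theorem densityJacobian_trans (hν : IsPositiveDensity ν) (hχ : IsPositiveDensity χ)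
    (F : M ≃ₘ⟮𝓡 n, 𝓡 n⟯ N) (G : N ≃ₘ⟮𝓡 n, 𝓡 n⟯ Q) (q : M) :
    densityJacobian μ χ (F.trans G) q =
      densityJacobian μ ν F q * densityJacobian ν χ G (F q) := by
  rw [densityJacobian, densityLift_trans, ← one_smul ℝ (μ q), densityLift_smul hν, one_mul,
    densityLift_smul hχ, hχ.densityRatio_mk]

theorem densityLift_densityPullback (F : M ≃ₘ⟮𝓡 n, 𝓡 n⟯ N) (ν : ∀ q : N, DensityFiber n N q)
    (q : M) : densityLift F ⟨q, densityPullback F ν q⟩ = ⟨F q, ν (F q)⟩ :=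
  congrArg (TotalSpace.mk (F q)) <| Density.ext fun v => congrArg (ν (F q)) <| funext fun i =>
    (F.mfderivToContinuousLinearEquiv (by simp) q).apply_symm_apply (v i)

theorem densityRatio_densityPullback_mul (hμ : IsPositiveDensity μ) (hν : IsPositiveDensity ν)
    (F : M ≃ₘ⟮𝓡 n, 𝓡 n⟯ N) (ρ : N → ℝ) (q : M) :
    densityRatio μ ⟨q, densityPullback F (fun p => ρ p • ν p) q⟩ * densityJacobian μ ν F q =
      ρ (F q) := by
  have hlift := densityLift_densityPullback F (fun p => ρ p • ν p) q
  rw [← hμ.densityRatio_smul (densityPullback F (fun p => ρ p • ν p) q),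
    densityLift_smul hν] at hlift
  simpa only [hν.densityRatio_mk] using congrArg (densityRatio ν) hlift

theorem densityJacobian_ne_zero (hμ : IsPositiveDensity μ) (hν : IsPositiveDensity ν)
    (F : M ≃ₘ⟮𝓡 n, 𝓡 n⟯ N) (q : M) : densityJacobian μ ν F q ≠ 0 :=
  right_ne_zero_of_mul_eq_one (densityRatio_densityPullback_mul hμ hν F (fun _ => 1) q)

theorem densityPullback_smul (hμ : IsPositiveDensity μ) (hν : IsPositiveDensity ν)
    (F : M ≃ₘ⟮𝓡 n, 𝓡 n⟯ N) (ρ : N → ℝ) (q : M) :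
    densityPullback F (fun p => ρ p • ν p) q = (ρ (F q) / densityJacobian μ ν F q) • μ q := by
  rw [← eq_div_of_mul_eq (densityJacobian_ne_zero hμ hν F q)
    (densityRatio_densityPullback_mul hμ hν F ρ q)]
  exact (hμ.densityRatio_smul _).symm

theorem IsSmoothTimeDepFlow.contMDiff_densityJacobian {φ : ℝ → ℝ → (M ≃ₘ⟮𝓡 n, 𝓡 n⟯ M)}
    {ν : ∀ q : M, DensityFiber n M q} (hφ : IsSmoothTimeDepFlow (𝓡 n) (fun t s => φ t s))
    (hμ : IsSmoothDensity μ) (hν : IsSmoothDensity ν) (hνpos : IsPositiveDensity ν) :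
    ContMDiff (𝓘(ℝ, ℝ).prod (𝓘(ℝ, ℝ).prod (𝓡 n))) 𝓘(ℝ, ℝ) ∞
      (fun x : ℝ × ℝ × M => densityJacobian μ ν (φ x.1 x.2.1) x.2.2) :=
  have hsection : ContMDiff (𝓘(ℝ, ℝ).prod (𝓘(ℝ, ℝ).prod (𝓡 n)))
      (𝓘(ℝ, ℝ).prod (𝓘(ℝ, ℝ).prod ((𝓡 n).prod 𝓘(ℝ, ℝ)))) ∞
      (fun x : ℝ × ℝ × M => (x.1, x.2.1, (⟨x.2.2, μ x.2.2⟩ : DensityBundle n M))) :=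
    contMDiff_fst.prodMk ((contMDiff_fst.comp contMDiff_snd).prodMk
      (ContMDiff.comp hμ (contMDiff_snd.comp contMDiff_snd)))
  (contMDiff_densityRatio hν hνpos).comp (hφ.densityLift.smooth.comp hsection)

end DensityJacobian

section VariationsFromFlows

variable {E : Type*} [NormedAddCommGroup E] [NormedSpace ℝ E] {H : Type*} [TopologicalSpace H]
  {I : ModelWithCorners ℝ E H} {M : Type*} [TopologicalSpace M] [ChartedSpace H M]

theorem IsInfinitesimalGenerator.isVariationOfIdentityAt {Φ : ℝ → ℝ → M → M}
    {X : ℝ → ∀ q : M, TangentSpace I q} (hX : IsInfinitesimalGenerator I Φ X)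
    (hΦ : IsSmoothTimeDepFlow I Φ) (t : ℝ) (q : M) :
    IsVariationOfIdentityAt I (fun τ => Φ τ t) (X t) t q where
  contMDiffAt :=
    have hslice : ContMDiff (𝓘(ℝ, ℝ).prod I) (𝓘(ℝ, ℝ).prod (𝓘(ℝ, ℝ).prod I)) ∞
        (fun p : ℝ × M => (p.1, t, p.2)) :=
      contMDiff_fst.prodMk (contMDiff_const.prodMk contMDiff_snd)
    (hΦ.smooth.comp hslice).contMDiffAt
  apply_self := hΦ.self t
  hasMFDerivAt p := by
    refine (hX t p).congr_mfderiv (congrArg (fun w : E => (1 : ℝ →L[ℝ] ℝ).smulRight w) ?_)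
    exact congrArg (fun p => (X t p : E)) (hΦ.self t p)

variable [IsManifold I ∞ M] [T2Space M] [I.Boundaryless] [CompleteSpace E] [HasContDiffBump E]

theorem isVariationOfIdentityAt_localFlow {X : ∀ q : M, TangentSpace I q}
    (hX : ContMDiff I I.tangent ∞ (T% X)) (q : M) :
    IsVariationOfIdentityAt I (localFlow I X) X 0 q where
  contMDiffAt := (followsIntegralCurves_localFlow hX).contMDiffAt_zero hX q
  apply_self := (followsIntegralCurves_localFlow hX).zero_apply hX
  hasMFDerivAt := (followsIntegralCurves_localFlow hX).hasMFDerivAt_zero hX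

end VariationsFromFlows

section Divergence

variable {n : ℕ} {M : Type*} [TopologicalSpace M] [ChartedSpace (EuclideanSpace ℝ (Fin n)) M]
  {μ : ∀ q : M, DensityFiber n M q} {X : ∀ q : M, TangentSpace (𝓡 n) q} {q : M}

theorem IsDivergenceAt.divergence_eq {c : ℝ} (h : IsDivergenceAt μ X q c)
    (hpos : IsPositiveDensity μ) : divergence μ X q = c := by
  have hdiv : IsDivergenceAt μ X q (divergence μ X q) := Classical.epsilon_spec ⟨c, h⟩
  let e : Module.Basis (Fin n) ℝ (TangentSpace (𝓡 n) q) := stdBasis n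
  exact mul_right_cancel₀ (hpos.apply_basis_pos q e).ne' ((hdiv e).unique (h e))

variable [IsManifold (𝓡 n) ∞ M]

/-- The divergence of `X` with respect to `μ` at the point `q`, computed in the chart at `q`. -/
def chartDivergence (μ : ∀ q : M, DensityFiber n M q) (X : ∀ q : M, TangentSpace (𝓡 n) q)
    (q : M) : ℝ :=
  chartLieDerivative μ X q / μ q (tangentFrame n _ q (mem_baseSet_trivializationAt _ _ q))

theorem IsVariationOfIdentityAt.hasDerivAt_densityPullback_apply {F : ℝ → M → M} {t₀ : ℝ}
    (hF : IsVariationOfIdentityAt (𝓡 n) F X t₀ q) (hμ : IsSmoothDensity μ)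
    (hpos : IsPositiveDensity μ) (v : Fin n → TangentSpace (𝓡 n) q) :
    HasDerivAt (fun τ => densityPullback (F τ) μ q v) (chartDivergence μ X q * μ q v) t₀ := by
  let e := tangentFrame n _ q (mem_baseSet_trivializationAt _ _ q)
  have hderiv := (hF.hasDerivAt_densityPullback hμ).const_mul |e.det v|
  simp only [← Density.apply_eq _ e v, e] at hderiv
  refine hderiv.congr_deriv ?_
  rw [Density.apply_eq (μ q) e v, chartDivergence, mul_left_comm,
    div_mul_cancel₀ _ (hpos.apply_basis_pos q e).ne']

variable [T2Space M]

theorem isDivergenceAt_chartDivergence (hX : ContMDiff (𝓡 n) (𝓡 n).tangent ∞ (T% X))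
    (hμ : IsSmoothDensity μ) (hpos : IsPositiveDensity μ) (q : M) :
    IsDivergenceAt μ X q (chartDivergence μ X q) :=
  (isVariationOfIdentityAt_localFlow hX q).hasDerivAt_densityPullback_apply hμ hpos

theorem divergence_eq_chartDivergence (hX : ContMDiff (𝓡 n) (𝓡 n).tangent ∞ (T% X))
    (hμ : IsSmoothDensity μ) (hpos : IsPositiveDensity μ) (q : M) :
    divergence μ X q = chartDivergence μ X q :=
  (isDivergenceAt_chartDivergence hX hμ hpos q).divergence_eq hpos

theorem isDivergenceAt_divergence (hX : ContMDiff (𝓡 n) (𝓡 n).tangent ∞ (T% X))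
    (hμ : IsSmoothDensity μ) (hpos : IsPositiveDensity μ) (q : M) :
    IsDivergenceAt μ X q (divergence μ X q) :=
  divergence_eq_chartDivergence hX hμ hpos q ▸ isDivergenceAt_chartDivergence hX hμ hpos q

end Divergence

section ParametricDerivative

variable {E : Type*} [NormedAddCommGroup E] [NormedSpace ℝ E] {H : Type*} [TopologicalSpace H]
  {J : ModelWithCorners ℝ E H} {P : Type*} [TopologicalSpace P] [ChartedSpace H P]
  [IsManifold J ∞ P] {F : Type*} [NormedAddCommGroup F] [NormedSpace ℝ F]

theorem contMDiff_deriv_param {g : P → ℝ → F} {h : P → ℝ}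
    (hg : ContMDiff (J.prod 𝓘(ℝ, ℝ)) 𝓘(ℝ, F) ∞ (Function.uncurry g))
    (hh : ContMDiff J 𝓘(ℝ, ℝ) ∞ h) :
    ContMDiff J 𝓘(ℝ, F) ∞ (fun p => deriv (g p) (h p)) := by
  intro p₀
  have hmfderiv := ContMDiffAt.mfderiv (m := ∞) g h hg.contMDiffAt (hh.contMDiffAt (x := p₀))
    (by simp)
  have hcoord : inTangentCoordinates 𝓘(ℝ, ℝ) 𝓘(ℝ, F) h (fun p => g p (h p))
      (fun p => (mfderiv 𝓘(ℝ, ℝ) 𝓘(ℝ, F) (g p) (h p) : ℝ →L[ℝ] F)) p₀ =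
        fun p => fderiv ℝ (g p) (h p) :=
    (inTangentCoordinates_model_space _ _ _ _).trans (funext fun p => mfderiv_eq_fderiv)
  have hfderiv : ContMDiffAt J 𝓘(ℝ, ℝ →L[ℝ] F) ∞ (fun p => fderiv ℝ (g p) (h p)) p₀ := by
    rw [← hcoord]
    exact hmfderiv
  exact hfderiv.clm_apply contMDiffAt_const

end ParametricDerivative

section FlowJacobian

variable {n : ℕ} {M : Type*} [TopologicalSpace M] [ChartedSpace (EuclideanSpace ℝ (Fin n)) M]
  [IsManifold (𝓡 n) ∞ M] {φ : ℝ → ℝ → (M ≃ₘ⟮𝓡 n, 𝓡 n⟯ M)}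
  {X : ℝ → ∀ q : M, TangentSpace (𝓡 n) q} {μ : ∀ q : M, DensityFiber n M q}

theorem IsSmoothTimeDepFlow.densityJacobian_self
    (hφ : IsSmoothTimeDepFlow (𝓡 n) (fun t s => φ t s)) (hpos : IsPositiveDensity μ) (t : ℝ)
    (q : M) : densityJacobian μ μ (φ t t) q = 1 := by
  rw [hφ.eq_refl, densityJacobian_refl hpos]

theorem densityPullback_eq_inv_densityJacobian_smul (hpos : IsPositiveDensity μ)
    (F : M ≃ₘ⟮𝓡 n, 𝓡 n⟯ M) (q : M) :
    densityPullback F μ q = (densityJacobian μ μ F q)⁻¹ • μ q := by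
  simpa only [one_smul, one_div] using densityPullback_smul hpos hpos F (fun _ => 1) q

/-- The function `ρ_t` with `ρ_t μ = (φ^{0,t})^* (ρ₀ μ)`. -/
def transportedRatio (φ : ℝ → ℝ → (M ≃ₘ⟮𝓡 n, 𝓡 n⟯ M)) (μ : ∀ q : M, DensityFiber n M q)
    (ρ₀ : M → ℝ) (t : ℝ) (q : M) : ℝ :=
  ρ₀ (φ 0 t q) / densityJacobian μ μ (φ 0 t) q

theorem transportedRatio_smul (hpos : IsPositiveDensity μ) (ρ₀ : M → ℝ) (t : ℝ) (q : M) :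
    transportedRatio φ μ ρ₀ t q • μ q = densityPullback (φ 0 t) (fun p => ρ₀ p • μ p) q :=
  (densityPullback_smul hpos hpos (φ 0 t) ρ₀ q).symm

theorem eq_transportedRatio (hpos : IsPositiveDensity μ) {ρ₀ : M → ℝ} {ρ : ℝ → M → ℝ}
    (hρ : ∀ t q, ρ t q • μ q = densityPullback (φ 0 t) (fun p => ρ₀ p • μ p) q) :
    ρ = transportedRatio φ μ ρ₀ := by
  funext t q
  rw [← hpos.densityRatio_mk (ρ t q), hρ, ← transportedRatio_smul hpos, hpos.densityRatio_mk]

theorem contMDiff_transportedRatio (hφ : IsSmoothTimeDepFlow (𝓡 n) (fun t s => φ t s))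
    (hμ : IsSmoothDensity μ) (hpos : IsPositiveDensity μ) {ρ₀ : M → ℝ}
    (hρ₀ : ContMDiff (𝓡 n) 𝓘(ℝ, ℝ) ∞ ρ₀) :
    ContMDiff (𝓘(ℝ, ℝ).prod (𝓡 n)) 𝓘(ℝ, ℝ) ∞
      (fun p : ℝ × M => transportedRatio φ μ ρ₀ p.1 p.2) := by
  have hslice : ContMDiff (𝓘(ℝ, ℝ).prod (𝓡 n)) (𝓘(ℝ, ℝ).prod (𝓘(ℝ, ℝ).prod (𝓡 n))) ∞
      (fun p : ℝ × M => ((0 : ℝ), p)) := contMDiff_const.prodMk contMDiff_id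
  have hnum : ContMDiff (𝓘(ℝ, ℝ).prod (𝓡 n)) 𝓘(ℝ, ℝ) ∞
      (fun p : ℝ × M => ρ₀ (φ 0 p.1 p.2)) := hρ₀.comp (hφ.smooth.comp hslice)
  have hden : ContMDiff (𝓘(ℝ, ℝ).prod (𝓡 n)) 𝓘(ℝ, ℝ) ∞
      (fun p : ℝ × M => densityJacobian μ μ (φ 0 p.1) p.2) :=
    ContMDiff.comp (g := fun x : ℝ × ℝ × M => densityJacobian μ μ (φ x.1 x.2.1) x.2.2)
      (f := fun p : ℝ × M => ((0 : ℝ), p)) (hφ.contMDiff_densityJacobian hμ hμ hpos) hslice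
  exact hnum.div₀ hden fun p => densityJacobian_ne_zero hpos hpos _ _

theorem transportedRatio_apply_flow (hφ : IsSmoothTimeDepFlow (𝓡 n) (fun t s => φ t s))
    (hpos : IsPositiveDensity μ) (ρ₀ : M → ℝ) (t : ℝ) (q : M) :
    transportedRatio φ μ ρ₀ t (φ t 0 q) = densityJacobian μ μ (φ t 0) q * ρ₀ q := by
  have hback : φ 0 t (φ t 0 q) = q := (hφ.comp 0 t 0 q).trans (hφ.self 0 q)
  have hcocycle : densityJacobian μ μ (φ t 0) q * densityJacobian μ μ (φ 0 t) (φ t 0 q) = 1 := by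
    rw [← densityJacobian_trans hpos hpos, ← hφ.eq_trans, hφ.densityJacobian_self hpos]
  rw [transportedRatio, hback, div_eq_iff (right_ne_zero_of_mul_eq_one hcocycle), mul_right_comm,
    hcocycle, one_mul]

variable [T2Space M]

theorem hasDerivAt_densityJacobian_self (hφ : IsSmoothTimeDepFlow (𝓡 n) (fun t s => φ t s))
    (hX : IsInfinitesimalGenerator (𝓡 n) (fun t s => φ t s) X) (hμ : IsSmoothDensity μ)
    (hpos : IsPositiveDensity μ) (t : ℝ) (q : M) :
    HasDerivAt (fun τ => densityJacobian μ μ (φ τ t) q) (-divergence μ (X t) q) t := by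
  let e : Module.Basis (Fin n) ℝ (TangentSpace (𝓡 n) q) := stdBasis n
  have hderiv := ((hX.isVariationOfIdentityAt hφ t q).hasDerivAt_densityPullback_apply
    hμ hpos e).div_const (μ q e)
  have hinv : (fun τ => densityPullback (φ τ t) μ q e / μ q e) =
      fun τ => (densityJacobian μ μ (φ τ t) q)⁻¹ := by
    funext τ
    rw [densityPullback_eq_inv_densityJacobian_smul hpos, Density.smul_apply,
      mul_div_cancel_right₀ _ (hpos.apply_basis_pos q e).ne']
  rw [hinv, mul_div_cancel_right₀ _ (hpos.apply_basis_pos q e).ne',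
    ← divergence_eq_chartDivergence ((hX.isSmoothTimeDepField hφ).contMDiff_apply t) hμ hpos q]
    at hderiv
  have hself := hφ.densityJacobian_self hpos t q
  simpa only [hself, Pi.inv_def, inv_inv, inv_one, one_pow, div_one] using
    hderiv.inv (by simp only [hself, inv_one, ne_eq, one_ne_zero, not_false_eq_true])

theorem hasDerivAt_densityJacobian (hφ : IsSmoothTimeDepFlow (𝓡 n) (fun t s => φ t s))
    (hX : IsInfinitesimalGenerator (𝓡 n) (fun t s => φ t s) X) (hμ : IsSmoothDensity μ)
    (hpos : IsPositiveDensity μ) (t s : ℝ) (q : M) :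
    HasDerivAt (fun τ => densityJacobian μ μ (φ τ s) q)
      (densityJacobian μ μ (φ t s) q * -divergence μ (X t) (φ t s q)) t := by
  have hcocycle : (fun τ => densityJacobian μ μ (φ τ s) q) = fun τ =>
      densityJacobian μ μ (φ t s) q * densityJacobian μ μ (φ τ t) (φ t s q) :=
    funext fun τ => by rw [hφ.eq_trans τ t s, densityJacobian_trans hpos hpos]
  rw [hcocycle]
  exact (hasDerivAt_densityJacobian_self hφ hX hμ hpos t (φ t s q)).const_mul _

theorem contMDiff_divergence (hφ : IsSmoothTimeDepFlow (𝓡 n) (fun t s => φ t s))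
    (hX : IsInfinitesimalGenerator (𝓡 n) (fun t s => φ t s) X) (hμ : IsSmoothDensity μ)
    (hpos : IsPositiveDensity μ) :
    ContMDiff (𝓘(ℝ, ℝ).prod (𝓡 n)) 𝓘(ℝ, ℝ) ∞
      (fun p : ℝ × M => divergence μ (X p.1) p.2) := by
  have hreorder : ContMDiff ((𝓘(ℝ, ℝ).prod (𝓡 n)).prod 𝓘(ℝ, ℝ))
      (𝓘(ℝ, ℝ).prod (𝓘(ℝ, ℝ).prod (𝓡 n))) ∞ (fun x : (ℝ × M) × ℝ => (x.2, x.1)) :=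
    contMDiff_snd.prodMk contMDiff_fst
  have hjacobian : ContMDiff ((𝓘(ℝ, ℝ).prod (𝓡 n)).prod 𝓘(ℝ, ℝ)) 𝓘(ℝ, ℝ) ∞
      (Function.uncurry fun (p : ℝ × M) (τ : ℝ) => densityJacobian μ μ (φ τ p.1) p.2) :=
    ContMDiff.comp (g := fun x : ℝ × ℝ × M => densityJacobian μ μ (φ x.1 x.2.1) x.2.2)
      (f := fun x : (ℝ × M) × ℝ => (x.2, x.1)) (hφ.contMDiff_densityJacobian hμ hμ hpos) hreorder
  have hderiv : ContMDiff (𝓘(ℝ, ℝ).prod (𝓡 n)) 𝓘(ℝ, ℝ) ∞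
      (fun p : ℝ × M => deriv (fun τ => densityJacobian μ μ (φ τ p.1) p.2) p.1) :=
    contMDiff_deriv_param hjacobian contMDiff_fst
  have hdivergence (p : ℝ × M) : divergence μ (X p.1) p.2 =
      -deriv (fun τ => densityJacobian μ μ (φ τ p.1) p.2) p.1 := by
    rw [(hasDerivAt_densityJacobian_self hφ hX hμ hpos p.1 p.2).deriv, neg_neg]
  simp only [hdivergence]
  exact hderiv.neg

theorem densityJacobian_eq_exp (hφ : IsSmoothTimeDepFlow (𝓡 n) (fun t s => φ t s))
    (hX : IsInfinitesimalGenerator (𝓡 n) (fun t s => φ t s) X) (hμ : IsSmoothDensity μ)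
    (hpos : IsPositiveDensity μ) (t s : ℝ) (q : M) :
    densityJacobian μ μ (φ t s) q =
      Real.exp (-∫ τ in s..t, divergence μ (X τ) (φ τ s q)) := by
  have hcont : Continuous fun τ => divergence μ (X τ) (φ τ s q) :=
    (contMDiff_divergence hφ hX hμ hpos).continuous.comp
      (continuous_id.prodMk (hφ.contMDiff_time s q).continuous)
  have hderiv : ∀ τ, HasDerivAt (fun τ => densityJacobian μ μ (φ τ s) q *
      Real.exp (∫ τ in s..τ, divergence μ (X τ) (φ τ s q))) 0 τ := fun τ =>
    ((hasDerivAt_densityJacobian hφ hX hμ hpos τ s q).mul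
      (hcont.integral_hasStrictDerivAt s τ).hasDerivAt.exp).congr_deriv (by ring)
  have hconst := is_const_of_deriv_eq_zero (fun τ => (hderiv τ).differentiableAt)
    (fun τ => (hderiv τ).deriv) t s
  simp only [intervalIntegral.integral_same, Real.exp_zero, mul_one,
    hφ.densityJacobian_self hpos] at hconst
  rw [Real.exp_neg]
  exact eq_inv_of_mul_eq_one_left hconst

theorem hasMFDerivAt_densityJacobian_prodMk (hφ : IsSmoothTimeDepFlow (𝓡 n) (fun t s => φ t s))
    (hX : IsInfinitesimalGenerator (𝓡 n) (fun t s => φ t s) X) (hμ : IsSmoothDensity μ)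
    (hpos : IsPositiveDensity μ) (t a : ℝ) (q : M) :
    HasMFDerivAt 𝓘(ℝ, ℝ) (𝓘(ℝ, ℝ).prod (𝓡 n))
      (fun τ => (a * densityJacobian μ μ (φ τ t) q, φ τ t q)) t
      ((1 : ℝ →L[ℝ] ℝ).smulRight
        ((-(a * divergence μ (X t) q), X t q) : ℝ × EuclideanSpace ℝ (Fin n))) := by
  have hfst := ((hasDerivAt_densityJacobian_self hφ hX hμ hpos t q).const_mul a).hasFDerivAt
  have hself : (X t (φ t t q) : EuclideanSpace ℝ (Fin n)) = X t q :=
    congrArg (fun p => (X t p : EuclideanSpace ℝ (Fin n))) (hφ.self t q)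
  refine (hfst.hasMFDerivAt.prodMk (hX t q)).congr_mfderiv (ContinuousLinearMap.ext_ring ?_)
  refine Prod.ext ?_ ?_
  · change (1 : ℝ) • (a * -divergence μ (X t) q) = (1 : ℝ) • -(a * divergence μ (X t) q)
    rw [mul_neg]
  · exact congrArg (fun w : EuclideanSpace ℝ (Fin n) => (1 : ℝ) • w) hself

theorem mfderiv_densityDiffeomorph (hφ : IsSmoothTimeDepFlow (𝓡 n) (fun t s => φ t s))
    (hX : IsInfinitesimalGenerator (𝓡 n) (fun t s => φ t s) X) (hμ : IsSmoothDensity μ)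
    (hpos : IsPositiveDensity μ) (t a : ℝ) (q : M) :
    mfderiv (𝓘(ℝ, ℝ).prod (𝓡 n)) ((𝓡 n).prod 𝓘(ℝ, ℝ)) (densityDiffeomorph hμ hpos) (a, q)
        ((-(a * divergence μ (X t) q), X t q) : ℝ × TangentSpace (𝓡 n) q) =
      flowGenerator ((𝓡 n).prod 𝓘(ℝ, ℝ)) (fun t s => densityLift (φ t s)) t
        (densityDiffeomorph hμ hpos (a, q)) := by
  have hbase : (a * densityJacobian μ μ (φ t t) q, φ t t q) = (a, q) := by
    rw [hφ.densityJacobian_self hpos, mul_one]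
    exact Prod.ext rfl (hφ.self t q)
  have hcurve : (fun τ => densityLift (φ τ t) (densityDiffeomorph hμ hpos (a, q))) =
      densityDiffeomorph hμ hpos ∘ fun τ => (a * densityJacobian μ μ (φ τ t) q, φ τ t q) :=
    funext fun τ => densityLift_smul hpos (φ τ t) a q
  have hcoord := hasMFDerivAt_densityJacobian_prodMk hφ hX hμ hpos t a q
  have htriv := (densityDiffeomorph hμ hpos).contMDiff.mdifferentiable (by simp) (a, q)
  rw [flowGenerator, hcurve, mfderiv_comp_of_eq htriv hcoord.mdifferentiableAt hbase,
    hcoord.mfderiv, hbase]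
  exact congrArg (mfderiv (𝓘(ℝ, ℝ).prod (𝓡 n)) ((𝓡 n).prod 𝓘(ℝ, ℝ))
    (densityDiffeomorph hμ hpos) (a, q)) (one_smul ℝ _).symm

theorem transportedRatio_eq_exp (hφ : IsSmoothTimeDepFlow (𝓡 n) (fun t s => φ t s))
    (hX : IsInfinitesimalGenerator (𝓡 n) (fun t s => φ t s) X) (hμ : IsSmoothDensity μ)
    (hpos : IsPositiveDensity μ) (ρ₀ : M → ℝ) (t : ℝ) (q : M) :
    transportedRatio φ μ ρ₀ t (φ t 0 q) =
      Real.exp (-∫ s in (0 : ℝ)..t, divergence μ (X s) (φ s 0 q)) * ρ₀ q := by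
  rw [transportedRatio_apply_flow hφ hpos, densityJacobian_eq_exp hφ hX hμ hpos]

theorem transportedRatio_pos (hφ : IsSmoothTimeDepFlow (𝓡 n) (fun t s => φ t s))
    (hX : IsInfinitesimalGenerator (𝓡 n) (fun t s => φ t s) X) (hμ : IsSmoothDensity μ)
    (hpos : IsPositiveDensity μ) {ρ₀ : M → ℝ} (t : ℝ) {q : M} (hq : 0 < ρ₀ q) :
    0 < transportedRatio φ μ ρ₀ t (φ t 0 q) := by
  rw [transportedRatio_eq_exp hφ hX hμ hpos]
  positivity

theorem log_transportedRatio (hφ : IsSmoothTimeDepFlow (𝓡 n) (fun t s => φ t s))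
    (hX : IsInfinitesimalGenerator (𝓡 n) (fun t s => φ t s) X) (hμ : IsSmoothDensity μ)
    (hpos : IsPositiveDensity μ) {ρ₀ : M → ℝ} (t : ℝ) {q : M} (hq : 0 < ρ₀ q) :
    Real.log (transportedRatio φ μ ρ₀ t (φ t 0 q)) =
      Real.log (ρ₀ q) - ∫ s in (0 : ℝ)..t, divergence μ (X s) (φ s 0 q) := by
  rw [transportedRatio_eq_exp hφ hX hμ hpos, Real.log_mul (Real.exp_pos _).ne' hq.ne',
    Real.log_exp, neg_add_eq_sub]

end FlowJacobian

end

theorem mainTheorem3_general (n : ℕ) (M : Type*) [TopologicalSpace M] [T2Space M]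
    [ChartedSpace (EuclideanSpace ℝ (Fin n)) M]
    [IsManifold (𝓡 n) ∞ M]
    (X : ℝ → ∀ q : M, TangentSpace (𝓡 n) q)
    (hX : IsSmoothTimeDepField (𝓡 n) X) (hc : IsCompleteField (𝓡 n) X) :
    ∃ φ : ℝ → ℝ → (M ≃ₘ⟮𝓡 n, 𝓡 n⟯ M),
      (∀ (t s : ℝ) (q : M), φ t s q = timeDepFlow (𝓡 n) X hc t s q) ∧
      IsSmoothTimeDepFlow (𝓡 n) (fun t s q => φ t s q) ∧
      IsSmoothTimeDepFlow ((𝓡 n).prod 𝓘(ℝ, ℝ)) (fun t s => densityLift (φ t s)) ∧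
      ∃ Xlift : ℝ → ∀ ψ : DensityBundle n M, TangentSpace ((𝓡 n).prod 𝓘(ℝ, ℝ)) ψ,
        IsSmoothTimeDepField ((𝓡 n).prod 𝓘(ℝ, ℝ)) Xlift ∧
        IsInfinitesimalGenerator ((𝓡 n).prod 𝓘(ℝ, ℝ)) (fun t s => densityLift (φ t s)) Xlift ∧
        (∀ (s : ℝ) (ψ : DensityBundle n M),
          IsTimeDepIntegralCurve ((𝓡 n).prod 𝓘(ℝ, ℝ)) Xlift
            (fun t => densityLift (φ t s) ψ)) ∧
        ∀ μ : ∀ q : M, DensityFiber n M q, IsSmoothDensity μ → IsPositiveDensity μ →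
          (∀ (t : ℝ) (q : M), IsDivergenceAt μ (X t) q (divergence μ (X t) q)) ∧
          ContMDiff (𝓘(ℝ, ℝ).prod (𝓡 n)) 𝓘(ℝ, ℝ) ∞
            (fun p : ℝ × M => divergence μ (X p.1) p.2) ∧
          (∃ Ψ : (ℝ × M) ≃ₘ⟮𝓘(ℝ, ℝ).prod (𝓡 n), (𝓡 n).prod 𝓘(ℝ, ℝ)⟯ DensityBundle n M,
            (∀ (a : ℝ) (q : M), Ψ (a, q) = ⟨q, a • μ q⟩) ∧
            ∀ (t a : ℝ) (q : M),
              mfderiv (𝓘(ℝ, ℝ).prod (𝓡 n)) ((𝓡 n).prod 𝓘(ℝ, ℝ)) Ψ (a, q)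
                  ((-(a * divergence μ (X t) q), X t q) : ℝ × TangentSpace (𝓡 n) q) =
                Xlift t (Ψ (a, q))) ∧
          ∀ ρ₀ : M → ℝ, ContMDiff (𝓡 n) 𝓘(ℝ, ℝ) ∞ ρ₀ →
            ∃ ρ : ℝ → M → ℝ,
              (∀ (t : ℝ) (q : M),
                ρ t q • μ q = densityPullback (φ 0 t) (fun p => ρ₀ p • μ p) q) ∧
              (∀ ρ' : ℝ → M → ℝ,
                (∀ (t : ℝ) (q : M),
                  ρ' t q • μ q = densityPullback (φ 0 t) (fun p => ρ₀ p • μ p) q) → ρ' = ρ) ∧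
              ContMDiff (𝓘(ℝ, ℝ).prod (𝓡 n)) 𝓘(ℝ, ℝ) ∞ (fun p : ℝ × M => ρ p.1 p.2) ∧
              (∀ (t : ℝ) (q : M),
                ρ t (φ t 0 q) =
                  Real.exp (-∫ s in (0 : ℝ)..t, divergence μ (X s) (φ s 0 q)) * ρ₀ q) ∧
              (∀ (t : ℝ) (q : M), 0 < ρ₀ q →
                0 < ρ t (φ t 0 q) ∧
                Real.log (ρ t (φ t 0 q)) =
                  Real.log (ρ₀ q) - ∫ s in (0 : ℝ)..t, divergence μ (X s) (φ s 0 q)) := by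
  let φ := (isSmoothTimeDepFlow_timeDepFlow hX hc).diffeomorph
  have hφ : IsSmoothTimeDepFlow (𝓡 n) (fun t s => φ t s) := isSmoothTimeDepFlow_timeDepFlow hX hc
  have hφX : IsInfinitesimalGenerator (𝓡 n) (fun t s => φ t s) X :=
    isInfinitesimalGenerator_timeDepFlow hc
  have hlift := hφ.densityLift
  have hgen := hlift.isInfinitesimalGenerator_flowGenerator
  refine ⟨φ, fun _ _ _ => rfl, hφ, hlift, flowGenerator _ (fun t s => densityLift (φ t s)),
    hlift.isSmoothTimeDepField_flowGenerator, hgen, hgen.isTimeDepIntegralCurve hlift,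
    fun μ hμ hpos => ⟨fun t => isDivergenceAt_divergence (hX.contMDiff_apply t) hμ hpos,
      contMDiff_divergence hφ hφX hμ hpos,
      ⟨densityDiffeomorph hμ hpos, fun _ _ => rfl, mfderiv_densityDiffeomorph hφ hφX hμ hpos⟩,
      fun ρ₀ hρ₀ => ?_⟩⟩
  exact ⟨transportedRatio φ μ ρ₀, transportedRatio_smul hpos ρ₀,
    fun ρ hρ => eq_transportedRatio hpos hρ, contMDiff_transportedRatio hφ hμ hpos hρ₀,
    transportedRatio_eq_exp hφ hφX hμ hpos ρ₀,
    fun t q hq => ⟨transportedRatio_pos hφ hφX hμ hpos t hq,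
      log_transportedRatio hφ hφX hμ hpos t hq⟩⟩

theorem mainTheorem3 (n : ℕ) (M : Type*) [TopologicalSpace M] [T2Space M]
    [SecondCountableTopology M] [ChartedSpace (EuclideanSpace ℝ (Fin n)) M]
    [IsManifold (𝓡 n) ∞ M]
    (X : ℝ → ∀ q : M, TangentSpace (𝓡 n) q)
    (hX : IsSmoothTimeDepField (𝓡 n) X) (hc : IsCompleteField (𝓡 n) X) :
    -- the flow maps `φ^{t,s}` of `X` are diffeomorphisms and form a smooth time-dependent flow
    ∃ φ : ℝ → ℝ → (M ≃ₘ⟮𝓡 n, 𝓡 n⟯ M),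
      (∀ (t s : ℝ) (q : M), φ t s q = timeDepFlow (𝓡 n) X hc t s q) ∧
      IsSmoothTimeDepFlow (𝓡 n) (fun t s q => φ t s q) ∧
      -- their lifts form a smooth time-dependent flow on the density bundle
      IsSmoothTimeDepFlow ((𝓡 n).prod 𝓘(ℝ, ℝ)) (fun t s => densityLift (φ t s)) ∧
      -- which has a smooth infinitesimal generator, and is the flow of that generator
      ∃ Xlift : ℝ → ∀ ψ : DensityBundle n M, TangentSpace ((𝓡 n).prod 𝓘(ℝ, ℝ)) ψ,
        IsSmoothTimeDepField ((𝓡 n).prod 𝓘(ℝ, ℝ)) Xlift ∧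
        IsInfinitesimalGenerator ((𝓡 n).prod 𝓘(ℝ, ℝ)) (fun t s => densityLift (φ t s)) Xlift ∧
        (∀ (s : ℝ) (ψ : DensityBundle n M),
          IsTimeDepIntegralCurve ((𝓡 n).prod 𝓘(ℝ, ℝ)) Xlift
            (fun t => densityLift (φ t s) ψ)) ∧
        ∀ μ : ∀ q : M, DensityFiber n M q, IsSmoothDensity μ → IsPositiveDensity μ →
          -- the divergences `div_μ X_t` exist and depend smoothly on `(t, q)`
          (∀ (t : ℝ) (q : M), IsDivergenceAt μ (X t) q (divergence μ (X t) q)) ∧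
          ContMDiff (𝓘(ℝ, ℝ).prod (𝓡 n)) 𝓘(ℝ, ℝ) ∞
            (fun p : ℝ × M => divergence μ (X p.1) p.2) ∧
          -- the generator in the global trivialization `(a, q) ↦ a μ_q`
          (∃ Ψ : (ℝ × M) ≃ₘ⟮𝓘(ℝ, ℝ).prod (𝓡 n), (𝓡 n).prod 𝓘(ℝ, ℝ)⟯ DensityBundle n M,
            (∀ (a : ℝ) (q : M), Ψ (a, q) = ⟨q, a • μ q⟩) ∧
            ∀ (t a : ℝ) (q : M),
              mfderiv (𝓘(ℝ, ℝ).prod (𝓡 n)) ((𝓡 n).prod 𝓘(ℝ, ℝ)) Ψ (a, q)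
                  ((-(a * divergence μ (X t) q), X t q) : ℝ × TangentSpace (𝓡 n) q) =
                Xlift t (Ψ (a, q))) ∧
          -- the transformed densities along the trajectories
          ∀ ρ₀ : M → ℝ, ContMDiff (𝓡 n) 𝓘(ℝ, ℝ) ∞ ρ₀ →
            ∃ ρ : ℝ → M → ℝ,
              (∀ (t : ℝ) (q : M),
                ρ t q • μ q = densityPullback (φ 0 t) (fun p => ρ₀ p • μ p) q) ∧
              (∀ ρ' : ℝ → M → ℝ,
                (∀ (t : ℝ) (q : M),
                  ρ' t q • μ q = densityPullback (φ 0 t) (fun p => ρ₀ p • μ p) q) → ρ' = ρ) ∧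
              ContMDiff (𝓘(ℝ, ℝ).prod (𝓡 n)) 𝓘(ℝ, ℝ) ∞ (fun p : ℝ × M => ρ p.1 p.2) ∧
              (∀ (t : ℝ) (q : M),
                ρ t (φ t 0 q) =
                  Real.exp (-∫ s in (0 : ℝ)..t, divergence μ (X s) (φ s 0 q)) * ρ₀ q) ∧
              (∀ (t : ℝ) (q : M), 0 < ρ₀ q →
                0 < ρ t (φ t 0 q) ∧
                Real.log (ρ t (φ t 0 q)) =
                  Real.log (ρ₀ q) - ∫ s in (0 : ℝ)..t, divergence μ (X s) (φ s 0 q)) :=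
  mainTheorem3_general n M X hX hc
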